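/- Conventions. Let $k,T>0$. For $x\in\{0,1\}^*$ let $\ell(x)$ be its length. A prefix Turing machine $M$ computes a partial computable function $\phi_M:\{0,1\}^*\to\{0,1\}^*$ whose domain $\mathrm{dom}\,\phi_M$ is prefix-free. Put $m_X(x)=2^{-\ell(x)}$ for $x\in\mathrm{dom}\,\phi_M$ and $m_X(x)=0$ otherwise, $m_Y(y)=\sum_{x:\phi_M(x)=y}2^{-\ell(x)}$, $\Omega_M=\sum_{x\in\mathrm{dom}\,\phi_M}2^{-\ell(x)}$, $p_X=m_X/\Omega_M$ (the coin-flipping distribution) and $p_Y=m_Y/\Omega_M$. A prefix machine $U$ is universal if there is a pairing $(\sigma,x)\mapsto\langle\sigma,x\rangle$ of strings (for example concatenation) with $\ell(\langle\sigma,x\rangle)\le \ell(x)+c_\sigma$ for all $\sigma,x$, such that for every prefix machine $M$ there is a string $\sigma$ with $\phi_U(\langle\sigma,x\rangle)=\phi_M(x)$ for all $x$ (both sides being defined for the same $x$). Put $K_U(y)=\min\{\ell(z):\phi_U(z)=y\}$. A process on a system with state space $\{0,1\}^*$ coupled to a heat bath at temperature $T$ consists of a nonempty discrete bath with Hamiltonian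 $H_B$, with finite partition function and finite mean energy at temperature $T$, and a reversible (bijective) joint evolution of system and bath. Its heat function $Q(x)$ is the increase of the expected energy of the bath when the system starts in $x$ and the bath in its Boltzmann distribution. A realization of $M$ with heat function $Q$ is a sequence of such processes (idealized bath limit), each of which takes every $x\in\mathrm{dom}\,\phi_M$ to $\phi_M(x)$ with certainty, with finite heat there, and whose heat functions converge to $Q$ pointwise on $\mathrm{dom}\,\phi_M$. A coin-flipping realization of $M$ is a realization with $Q_{\mathrm{coin}}(x)=kT\,(-\ln p_X(x)+\ln p_Y(\phi_M(x)))$ for all $x\in\mathrm{dom}\,\phi_M$. The entropy production on an input distribution $p$ supported in $\mathrm{dom}\,\phi_M$ is $\Sigma(p)=S(p_{\phi_M(X)})-S(p)+\langle Q\rangle_p/kT$, with $S$ the Shannon entropy in nats; if the terms may be infinite, $\Sigma(p)$ is the limit of $\Sigma(p(\cdot\mid F))$ along the finite sets $F$ ordered by inclusion. Claim. (1) For every prefix machine $M$: if $\mathrm{dom}\,\phi_M\neq\emptyset$, then $p_X$ is a probability distribution; a coin-flipping realization of $M$ exists; and every coin-flipping realization of $M$ satisfies $$Q_{\mathrm{coin}}(x)=kT\ln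 2\,\bigl(\ell(x)+\log_2 m_Y(\phi_M(x))\bigr)\qquad\text{for all }x\in\mathrm{dom}\,\phi_M,$$ and is thermodynamically reversible on the coin-flipping distribution: $\Sigma(p_X)=0$ in the sense of the limit; and if $S(p_X)<\infty$, then all three terms of the formula for $\Sigma(p_X)$ are finite and they add up to $0$. (2) For all universal prefix machines $U$ and $V$ there is a constant $\kappa$ such that for every coin-flipping realization of $U$ and all $x\in\mathrm{dom}\,\phi_U$, $$\bigl|Q_{\mathrm{coin}}(x)-kT\ln 2\,\bigl(\ell(x)-K_V(\phi_U(x))\bigr)\bigr|\le\kappa .$$ In particular this holds with $K=K_U$. (3) For every universal prefix machine $U$ there is a constant $\kappa$ such that for every coin-flipping realization of $U$ and every $y\in\{0,1\}^*$, the minimum $\min_{x:\phi_U(x)=y}Q_{\mathrm{coin}}(x)$ (the thermodynamic complexity of $y$) is attained and has absolute value at most $\kappa$. -/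

import Mathlib

open Filter Topology

namespace TMThermo

/-! ### Prefix Turing machines and Kolmogorov complexity -/

/-- A prefix Turing machine, given through the partial function `φ : {0,1}* → {0,1}*` that it
computes: a partial computable function whose domain of definition (the halting set) is
prefix-free. -/
structure PrefixMachine where
  /-- The partial function on binary strings computed by the machine. -/
  φ : List Bool →. List Bool
  partrec : Partrec φ
  prefixFree : ∀ x ∈ φ.Dom, ∀ x' ∈ φ.Dom, x <+: x' → x = x'

/-- `U` is universal: relative to some way `pair σ x` of feeding an interpreter program `σ`
together with an input `x` (for instance `σ ++ x`), which lengthens `x` by at most a constant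
depending on `σ`, every prefix machine `M` is simulated by `U` through an interpreter program. -/
def PrefixMachine.IsUniversal (U : PrefixMachine) : Prop :=
  ∃ pair : List Bool → List Bool → List Bool,
    (∀ σ, ∃ c : ℕ, ∀ x, (pair σ x).length ≤ x.length + c) ∧
    ∀ M : PrefixMachine, ∃ σ, ∀ x, U.φ (pair σ x) = M.φ x

/-- Kolmogorov complexity `K_U(y)`, the length of a shortest program for `y`. -/
noncomputable def PrefixMachine.kolmogorov (U : PrefixMachine) (y : List Bool) : ℕ :=
  sInf {n | ∃ z, y ∈ U.φ z ∧ z.length = n}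

/-! ### The coin-flipping distribution -/

open Classical in
/-- `m_X(x) = 2^{-ℓ(x)}` on the halting set, `0` elsewhere. -/
noncomputable def PrefixMachine.mX (M : PrefixMachine) (x : List Bool) : ℝ :=
  if x ∈ M.φ.Dom then (1 / 2 : ℝ) ^ x.length else 0

/-- `m_Y(y) = ∑_{x : φ(x) = y} 2^{-ℓ(x)}`. -/
noncomputable def PrefixMachine.mY (M : PrefixMachine) (y : List Bool) : ℝ :=
  ∑' x : {x : List Bool // y ∈ M.φ x}, (1 / 2 : ℝ) ^ x.1.length

/-- The halting probability. -/
noncomputable def PrefixMachine.haltingProb (M : PrefixMachine) : ℝ :=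
  ∑' x : {x : List Bool // x ∈ M.φ.Dom}, (1 / 2 : ℝ) ^ x.1.length

/-- The normalized coin-flipping distribution over inputs. -/
noncomputable def PrefixMachine.coinInput (M : PrefixMachine) (x : List Bool) : ℝ :=
  M.mX x / M.haltingProb

/-- The normalized distribution over outputs. -/
noncomputable def PrefixMachine.coinOutput (M : PrefixMachine) (y : List Bool) : ℝ :=
  M.mY y / M.haltingProb

/-! ### Physical processes and realizations -/

/-- A driven physical process on a system with discrete state space `X`, coupled to a work
reservoir and to a heat bath at temperature `T` (with `kT` the thermal energy). The bath has
states `Bath`, bare Hamiltonian `energy`, a finite partition function and a finite mean energy at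
temperature `T`. Over the duration of the process, the joint states of system and bath evolve
reversibly under the driven joint Hamiltonian. -/
structure BathProcess (X : Type) (kT : ℝ) where
  Bath : Type
  nonempty : Nonempty Bath
  energy : Bath → ℝ
  evolve : X × Bath ≃ X × Bath
  summable_boltzmann : Summable fun b => Real.exp (-energy b / kT)
  summable_energy : Summable fun b => Real.exp (-energy b / kT) * energy b

/-- The Boltzmann distribution of the bath, its initial state whatever the system's state is. -/
noncomputable def BathProcess.boltzmann {X : Type} {kT : ℝ} (P : BathProcess X kT)
    (b : P.Bath) : ℝ :=
  Real.exp (-P.energy b / kT) / ∑' b', Real.exp (-P.energy b' / kT)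

/-- The increase of the expected energy of the bath when the system starts in state `x`. -/
noncomputable def BathProcess.heat {X : Type} {kT : ℝ} (P : BathProcess X kT) (x : X) : ℝ :=
  (∑' b, P.boltzmann b * P.energy (P.evolve (x, b)).2) - ∑' b, P.boltzmann b * P.energy b

/-- A realization of the partial function `f` with an (idealized) heat bath: a sequence of
processes, each of which takes every `x` in the domain of `f` to the final state `f x` with
probability one (equivalently, as the Boltzmann distribution has full support, for every initial
state of the bath), together with a heat function `heat` to which their heat functions converge
on the domain of `f`. A single process with a fixed bath is the case of a constant sequence. -/
structure Realization {X : Type} (f : X →. X) (kT : ℝ) where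
  process : ℕ → BathProcess X kT
  realizes : ∀ n x y, y ∈ f x → ∀ b, ((process n).evolve (x, b)).1 = y
  summable_final : ∀ n, ∀ x ∈ f.Dom,
    Summable fun b => (process n).boltzmann b * (process n).energy ((process n).evolve (x, b)).2
  heat : X → ℝ
  tendsto_heat : ∀ x ∈ f.Dom, Tendsto (fun n => (process n).heat x) atTop (𝓝 (heat x))

/-! ### Entropy production and thermodynamic complexity -/

/-- Shannon entropy in nats. -/
noncomputable def shannonEntropy {X : Type} (p : X → ℝ) : ℝ := ∑' x, Real.negMulLog (p x)

/-- The distribution of `f(X)` when `X` has distribution `p`, supported in the domain of `f`. -/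
noncomputable def outputDist {X : Type} (f : X →. X) (p : X → ℝ) (y : X) : ℝ :=
  ∑' x : {x : X // y ∈ f x}, p x

open Classical in
/-- The distribution `p` conditioned on the finite set `F`. -/
noncomputable def condOn {X : Type} (p : X → ℝ) (F : Finset X) (x : X) : ℝ :=
  if x ∈ F then p x / ∑ x' ∈ F, p x' else 0

namespace Realization

variable {X : Type} {f : X →. X} {kT : ℝ}

/-- Expected entropy production `S(p_Y) - S(p_X) + ⟨Q⟩ / kT` for the input distribution `p`,
meaningful when the three terms are finite. -/
noncomputable def entropyProduction (R : Realization f kT) (p : X → ℝ) : ℝ :=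
  shannonEntropy (outputDist f p) - shannonEntropy p + (∑' x, p x * R.heat x) / kT

/-- The entropy production of `R` on `p` is `s`, also when the entropies or the expected heat are
infinite: the limit of the entropy productions on the finitely supported conditionings of `p`. -/
def HasEntropyProduction (R : Realization f kT) (p : X → ℝ) (s : ℝ) : Prop :=
  Tendsto (fun F : Finset X => R.entropyProduction (condOn p F)) atTop (𝓝 s)

/-- The heat values of the inputs that lead to output `y`. -/
def heatsOf (R : Realization f kT) (y : X) : Set ℝ := {q | ∃ x, y ∈ f x ∧ R.heat x = q}

/-- The least heat that is needed to produce output `y`. -/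
noncomputable def thermoComplexity (R : Realization f kT) (y : X) : ℝ := sInf (R.heatsOf y)

end Realization

/-- `R` is a coin-flipping realization of `M`: its heat function is
`kT (- ln p_X(x) + ln p_Y(φ(x)))` for the normalized coin-flipping distributions. -/
def PrefixMachine.IsCoinFlipping (M : PrefixMachine) {kT : ℝ} (R : Realization M.φ kT) : Prop :=
  ∀ x y, y ∈ M.φ x → R.heat x = kT * (-Real.log (M.coinInput x) + Real.log (M.coinOutput y))

end TMThermo

/-! Existence is a counting argument. Give level `j` of a bath about `exp (θ j)` states and energy
`kT a j` with `a` slightly above `θ`. If input `x` lifts the bath by `s x` levels, output `y` at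
level `j` has to absorb `d (j - s x)` states for each `x` in the fiber of `y`, and there is room as
soon as `∑ exp (-θ s x) ≤ 1` on that fiber. The map is then injective and extends to a bijection,
because infinitely many joint states remain free on both sides. The heat is exactly `kT a s x`. As
`θ → 0` and `a / θ → 1`, every nonnegative `Q` with `∑ exp (-Q / kT) ≤ 1` on fibers is reached in
the limit (`exists_realization`). For the coin-flipping heat, `exp (-Q x / kT) = m_X(x) / m_Y(φ x)`,
so the inequality holds by the definition of `m_Y`.

Reversibility: conditioned on a finite set of probability `P`, the entropy production is the mean of
`ln (p_Y / (P q))`, with `q` the conditioned output distribution. It lies between `0` (as `P q ≤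
p_Y`) and `1 / P - 1` (as `ln t ≤ t - 1`), and `P → 1`.

The statements on universal machines reduce to `log₂ m_Y(y) = -K_V(y) + O(1)`. One direction is
simulation: a shortest program for `V` gives a term of the sum `m_Y`. The other is Levin's coding
theorem (`exists_coding_machine`): `m_Y` is approximated from below, a codeword of length `n + 2` is
requested for `y` once `m_Y(y) ≥ 2 ^ (-n)` has been seen, and a Kraft-Chaitin allocation turns the
requests into a prefix machine. The least heat for `y` is then attained at a shortest program, where
length and `-log₂ m_Y(y)` differ by a bounded amount. -/

namespace TMThermo

/-! ### Kraft's inequality for prefix-free sets -/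

section Kraft

/-- The first words of two factorizations of a string are both prefixes of it, hence comparable,
hence equal; they cancel. The empty word is excluded because it can be inserted at will. -/
theorem uniquelyDecodable_of_prefixFree {α : Type*} {S : Set (List α)} (hnil : [] ∉ S)
    (hS : ∀ x ∈ S, ∀ x' ∈ S, x <+: x' → x = x') : InformationTheory.UniquelyDecodable S := by
  intro L₁
  induction L₁ with
  | nil =>
    intro L₂ _ h₂ h
    cases L₂ with
    | nil => rfl
    | cons b L =>
      have hb : b = [] := by
        have := h.symm
        simp at this
        exact this.1
      exact absurd (hb ▸ h₂ b (by simp)) hnil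
  | cons a L ih =>
    intro L₂ h₁ h₂ h
    cases L₂ with
    | nil =>
      have ha : a = [] := by
        simp at h
        exact h.1
      exact absurd (ha ▸ h₁ a (by simp)) hnil
    | cons b L' =>
      have ha := h₁ a (by simp)
      have hb := h₂ b (by simp)
      simp only [List.flatten_cons] at h
      have hab : a = b := by
        have h1 : a <+: a ++ L.flatten := List.prefix_append _ _
        have h2 : b <+: a ++ L.flatten := h ▸ List.prefix_append _ _
        rcases List.prefix_or_prefix_of_prefix h1 h2 with h3 | h3
        · exact hS _ ha _ hb h3
        · exact (hS _ hb _ ha h3).symm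
      subst hab
      rw [ih L' (fun w hw => h₁ w (by simp [hw])) (fun w hw => h₂ w (by simp [hw]))
        (List.append_cancel_left h)]

/-- Kraft's inequality for finite prefix-free sets of binary strings. -/
theorem kraft_of_prefixFree (S : Finset (List Bool))
    (hS : ∀ x ∈ S, ∀ x' ∈ S, x <+: x' → x = x') :
    ∑ x ∈ S, (1 / 2 : ℝ) ^ x.length ≤ 1 := by
  -- The empty word is a prefix of every string, so a prefix-free set that contains it contains
  -- nothing else. This case needs separate treatment, since unique decodability fails.
  by_cases hnil : [] ∈ S
  · have : S = {[]} := by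
      ext x
      simp only [Finset.mem_singleton]
      exact ⟨fun hx => (hS _ hnil _ hx List.nil_prefix).symm, fun hx => hx ▸ hnil⟩
    simp [this]
  · have := InformationTheory.kraft_mcmillan_inequality (S := S)
      (uniquelyDecodable_of_prefixFree (by simpa using hnil) (by simpa using hS))
    simpa using this

end Kraft

/-! ### The coin-flipping distribution -/

namespace PrefixMachine

variable (M : PrefixMachine)

theorem sum_dom_le_one (u : Finset {x : List Bool // x ∈ M.φ.Dom}) :
    ∑ x ∈ u, (1 / 2 : ℝ) ^ x.1.length ≤ 1 := by
  have := kraft_of_prefixFree (u.map (Function.Embedding.subtype _)) (by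
    intro x hx x' hx' h
    simp only [Finset.mem_map, Function.Embedding.subtype_apply] at hx hx'
    obtain ⟨a, -, rfl⟩ := hx
    obtain ⟨b, -, rfl⟩ := hx'
    exact M.prefixFree _ a.2 _ b.2 h)
  simpa using this

theorem summable_dom :
    Summable fun x : {x : List Bool // x ∈ M.φ.Dom} => (1 / 2 : ℝ) ^ x.1.length :=
  summable_of_sum_le (fun _ => by positivity) M.sum_dom_le_one

theorem mX_eq_indicator :
    M.mX = Set.indicator M.φ.Dom fun x => (1 / 2 : ℝ) ^ x.length := by
  ext x
  by_cases hx : x ∈ M.φ.Dom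
  · rw [mX, if_pos hx, Set.indicator_of_mem hx]
  · rw [mX, if_neg hx, Set.indicator_of_notMem hx]

theorem mX_of_mem {x : List Bool} (hx : x ∈ M.φ.Dom) : M.mX x = (1 / 2 : ℝ) ^ x.length :=
  if_pos hx

theorem mX_nonneg (x : List Bool) : 0 ≤ M.mX x := by
  unfold mX
  split_ifs <;> positivity

theorem summable_mX : Summable M.mX := by
  rw [mX_eq_indicator, ← summable_subtype_iff_indicator]
  exact M.summable_dom

theorem hasSum_mX : HasSum M.mX M.haltingProb := by
  have h := M.summable_dom.hasSum
  rw [mX_eq_indicator]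
  exact (hasSum_subtype_iff_indicator (f := fun x : List Bool => (1 / 2 : ℝ) ^ x.length)).1 h

theorem haltingProb_pos (h : M.φ.Dom.Nonempty) : 0 < M.haltingProb := by
  obtain ⟨x, hx⟩ := h
  exact M.summable_dom.tsum_pos (fun _ => by positivity) ⟨x, hx⟩ (by positivity)

theorem haltingProb_nonneg : 0 ≤ M.haltingProb := tsum_nonneg fun _ => by positivity

theorem mem_dom {M : PrefixMachine} {x y : List Bool} (h : y ∈ M.φ x) : x ∈ M.φ.Dom :=
  Part.dom_iff_mem.2 ⟨y, h⟩

theorem summable_fiber (y : List Bool) :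
    Summable fun x : {x : List Bool // y ∈ M.φ x} => (1 / 2 : ℝ) ^ x.1.length := by
  have h := M.summable_mX.subtype {x | y ∈ M.φ x}
  refine h.congr fun x => ?_
  exact M.mX_of_mem (mem_dom x.2)

theorem sum_fiber_le {y : List Bool} {F : Finset (List Bool)} (hF : ∀ x ∈ F, y ∈ M.φ x) :
    ∑ x ∈ F, (1 / 2 : ℝ) ^ x.length ≤ M.mY y := by
  classical
  have := (M.summable_fiber y).sum_le_tsum (F.subtype fun x => y ∈ M.φ x)
    fun _ _ => by positivity
  rw [Finset.sum_subtype_of_mem (fun x : List Bool => (1 / 2 : ℝ) ^ x.length) hF] at this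
  exact this

theorem pow_le_mY {x y : List Bool} (h : y ∈ M.φ x) : (1 / 2 : ℝ) ^ x.length ≤ M.mY y :=
  (M.summable_fiber y).le_tsum (⟨x, h⟩ : {x : List Bool // y ∈ M.φ x})
    fun _ _ => by positivity

theorem mY_pos {x y : List Bool} (h : y ∈ M.φ x) : 0 < M.mY y :=
  lt_of_lt_of_le (by positivity) (M.pow_le_mY h)

theorem mY_nonneg (y : List Bool) : 0 ≤ M.mY y := tsum_nonneg fun _ => by positivity

theorem coinInput_nonneg (x : List Bool) : 0 ≤ M.coinInput x :=
  div_nonneg (M.mX_nonneg x) M.haltingProb_nonneg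

theorem coinInput_pos {x : List Bool} (hx : x ∈ M.φ.Dom) : 0 < M.coinInput x := by
  have := M.haltingProb_pos ⟨x, hx⟩
  rw [coinInput, mX_of_mem _ hx]
  positivity

theorem coinInput_eq_zero {x : List Bool} (hx : x ∉ M.φ.Dom) : M.coinInput x = 0 := by
  simp [coinInput, mX, hx]

theorem summable_coinInput : Summable M.coinInput := M.summable_mX.div_const _

theorem hasSum_coinInput (h : M.φ.Dom.Nonempty) : HasSum M.coinInput 1 := by
  have := M.hasSum_mX.div_const M.haltingProb
  rwa [div_self (M.haltingProb_pos h).ne'] at this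

theorem outputDist_coinInput : outputDist M.φ M.coinInput = M.coinOutput := by
  ext y
  rw [outputDist, coinOutput, mY, ← tsum_div_const]
  refine tsum_congr fun x => ?_
  rw [coinInput, mX_of_mem _ (mem_dom x.2)]

theorem coinOutput_pos {x y : List Bool} (h : y ∈ M.φ x) : 0 < M.coinOutput y :=
  div_pos (M.mY_pos h) (M.haltingProb_pos ⟨x, mem_dom h⟩)

theorem coin_heat_eq {x y : List Bool} (h : y ∈ M.φ x) :
    -Real.log (M.coinInput x) + Real.log (M.coinOutput y)
      = Real.log 2 * (x.length + Real.logb 2 (M.mY y)) := by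
  have hΩ := (M.haltingProb_pos ⟨x, mem_dom h⟩).ne'
  have hy := (M.mY_pos h).ne'
  have h2 : Real.log 2 ≠ 0 := (Real.log_pos one_lt_two).ne'
  rw [coinInput, coinOutput, mX_of_mem _ (mem_dom h), Real.log_div (by positivity) hΩ,
    Real.log_div hy hΩ, Real.log_pow, one_div, Real.log_inv, Real.logb]
  field_simp
  ring

/-- An input on which the machine does not halt leaves the joint evolution the free states that it
needs to become a bijection. -/
theorem exists_notMem_dom : ∃ x, x ∉ M.φ.Dom := by
  by_contra! h
  have := M.prefixFree [] (h _) [true] (h _) List.nil_prefix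
  simp at this

end PrefixMachine
-- Extending injections to permutations
section Extension

/-- Bounding only the finite subsets makes finiteness of `S` part of the conclusion, so that a fiber
of joint states can be numbered without knowing beforehand that it is finite. -/
theorem exists_injOn_nat_of_card_le {Z : Type*} {S : Set Z} {n : ℕ}
    (h : ∀ T : Finset Z, ↑T ⊆ S → T.card ≤ n) :
    ∃ e : Z → ℕ, Set.InjOn e S ∧ ∀ z ∈ S, e z < n := by
  classical
  have hfin : S.Finite := by
    by_contra hinf
    obtain ⟨T, hT, hc⟩ := Set.Infinite.exists_subset_card_eq hinf (n + 1)
    have := h T hT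
    omega
  have hcard : hfin.toFinset.card ≤ n := h _ (by simp)
  let e := hfin.toFinset.equivFin
  refine ⟨fun z => if hz : z ∈ hfin.toFinset then e ⟨z, hz⟩ else 0, ?_, ?_⟩
  · intro z hz z' hz' hzz
    have h1 : z ∈ hfin.toFinset := by simpa using hz
    have h2 : z' ∈ hfin.toFinset := by simpa using hz'
    simp only [h1, h2, dif_pos] at hzz
    have := e.injective (Fin.ext hzz)
    simpa using this
  · intro z hz
    have h1 : z ∈ hfin.toFinset := by simpa using hz
    simp only [h1, dif_pos]
    exact lt_of_lt_of_le (e _).2 hcard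

/-- The complements of `D` and of its image are both countably infinite, so any bijection between
them completes `g`. -/
theorem exists_equiv_extending {Z : Type*} [Countable Z] {D : Set Z} {g : Z → Z}
    (hg : Set.InjOn g D) (hD : Dᶜ.Infinite) (hgD : (g '' D)ᶜ.Infinite) :
    ∃ e : Z ≃ Z, ∀ z ∈ D, e z = g z := by
  classical
  have : Infinite {z // ¬ z ∈ D} := hD.to_subtype
  have : Infinite {z // ¬ z ∈ g '' D} := hgD.to_subtype
  obtain ⟨e₂⟩ : Nonempty ({z // ¬ z ∈ D} ≃ {z // ¬ z ∈ g '' D}) :=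
    nonempty_equiv_of_countable
  let e₁ : {z // z ∈ D} ≃ {z // z ∈ g '' D} := Equiv.Set.imageOfInjOn g D hg
  refine ⟨Equiv.subtypeCongr e₁ e₂, fun z hz => ?_⟩
  rw [Equiv.subtypeCongr]
  simp [Equiv.sumCompl_symm_apply_of_pos, hz, e₁, Equiv.Set.imageOfInjOn]

end Extension

/-! ### Heat baths with exponentially growing degeneracy -/

section Bath

/-- The state space of a bath whose `j`-th energy level has degeneracy `d j`. -/
abbrev LevelBath (d : ℕ → ℕ) : Type := Σ j : ℕ, Fin (d j)

theorem summable_levelBath {d : ℕ → ℕ} {w : ℕ → ℝ} (hw : ∀ j, 0 ≤ w j)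
    (h : Summable fun j => (d j : ℝ) * w j) : Summable fun b : LevelBath d => w b.1 := by
  rw [summable_sigma_of_nonneg fun b => hw b.1]
  refine ⟨fun j => Summable.of_finite, ?_⟩
  simpa using h

/-- The joint states that have to end with output `y` and bath level `j` number at most `∑ d (j - s
x)`, over the `x` in the fiber with `s x ≤ j`. By `hsum` they fit into the `d j` states available
there. -/
theorem exists_shift {X : Type} [Countable X] [Infinite X] {f : X →. X} (hf : ∃ x, x ∉ f.Dom)
    {d : ℕ → ℕ} (hd : ∀ j, 0 < d j) {s : X → ℕ} (hs : ∀ x ∈ f.Dom, 1 ≤ s x)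
    (hsum : ∀ y j, ∀ F : Finset X, (∀ x ∈ F, y ∈ f x ∧ s x ≤ j) →
      ∑ x ∈ F, d (j - s x) ≤ d j) :
    ∃ e : X × LevelBath d ≃ X × LevelBath d, ∀ x y, y ∈ f x → ∀ b,
      (e (x, b)).1 = y ∧ (e (x, b)).2.1 = b.1 + s x := by
  classical
  have key : ∀ y j, ∃ e : X × LevelBath d → ℕ,
      Set.InjOn e {p | y ∈ f p.1 ∧ p.2.1 + s p.1 = j} ∧
      ∀ p ∈ {p : X × LevelBath d | y ∈ f p.1 ∧ p.2.1 + s p.1 = j}, e p < d j := by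
    intro y j
    refine exists_injOn_nat_of_card_le fun T hT => ?_
    refine le_trans ?_ (hsum y j (T.image Prod.fst) ?_)
    · rw [Finset.card_eq_sum_card_image Prod.fst T]
      refine Finset.sum_le_sum fun x _ => ?_
      have : (Finset.range (d (j - s x))).card = d (j - s x) := by simp
      rw [← this]
      refine Finset.card_le_card_of_injOn (fun p => (p.2.2 : ℕ)) ?_ ?_
      · intro p hp
        simp only [Finset.coe_filter, Set.mem_ofPred_eq] at hp
        obtain ⟨hp, rfl⟩ := hp
        have h1 := (hT hp).2
        have h2 : p.2.1 = j - s p.1 := by omega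
        simp only [Finset.coe_range, Set.mem_Iio]
        rw [← h2]
        exact p.2.2.2
      · rintro ⟨x₁, j₁, k₁⟩ h₁ ⟨x₂, j₂, k₂⟩ h₂ h
        simp only [Finset.coe_filter, Set.mem_ofPred_eq] at h₁ h₂ h
        obtain ⟨h₁, rfl⟩ := h₁
        obtain ⟨h₂, rfl⟩ := h₂
        have h3 := (hT h₁).2
        have h4 := (hT h₂).2
        simp only at h3 h4
        obtain rfl : j₁ = j₂ := by omega
        rw [Fin.ext h]
    · intro x hx
      obtain ⟨p, hp, rfl⟩ := Finset.mem_image.1 hx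
      have h1 := hT hp
      exact ⟨h1.1, by have := h1.2; omega⟩
  choose e he_inj he_lt using key
  let g : X × LevelBath d → X × LevelBath d := fun p =>
    if hp : (f p.1).Dom then
      ((f p.1).get hp, ⟨p.2.1 + s p.1, ⟨e ((f p.1).get hp) (p.2.1 + s p.1) p,
        he_lt _ _ p ⟨Part.get_mem hp, rfl⟩⟩⟩)
    else p
  have hg : ∀ x y, y ∈ f x → ∀ b, (g (x, b)).1 = y ∧ (g (x, b)).2.1 = b.1 + s x ∧
      ((g (x, b)).2.2 : ℕ) = e y (b.1 + s x) (x, b) := by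
    intro x y hy b
    obtain ⟨hx, rfl⟩ := hy
    have hgx : g (x, b) = ((f x).get hx, ⟨b.1 + s x, ⟨e ((f x).get hx) (b.1 + s x) (x, b),
      he_lt _ _ (x, b) ⟨Part.get_mem hx, rfl⟩⟩⟩) := dif_pos hx
    rw [hgx]
    exact ⟨rfl, rfl, rfl⟩
  obtain ⟨x₀, hx₀⟩ := hf
  have hinj : Set.InjOn g {p | p.1 ∈ f.Dom} := by
    rintro ⟨x, b⟩ hx ⟨x', b'⟩ hx' h
    obtain ⟨y, hy⟩ := Part.dom_iff_mem.1 hx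
    obtain ⟨y', hy'⟩ := Part.dom_iff_mem.1 hx'
    have h1 := hg x y hy b
    have h2 := hg x' y' hy' b'
    rw [h] at h1
    obtain rfl : y = y' := h1.1.symm.trans h2.1
    have h3 : b.1 + s x = b'.1 + s x' := h1.2.1.symm.trans h2.2.1
    have h4 := h1.2.2.symm.trans h2.2.2
    rw [← h3] at h4
    exact he_inj y (b.1 + s x) ⟨hy, rfl⟩ ⟨hy', h3.symm⟩ h4
  -- The input `x₀` outside the domain is unconstrained at every bath level.
  have hD : ({p : X × LevelBath d | p.1 ∈ f.Dom}ᶜ).Infinite := by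
    refine Set.infinite_of_injective_forall_mem
      (f := fun j : ℕ => ((x₀, ⟨j, ⟨0, hd j⟩⟩) : X × LevelBath d)) ?_ fun j => hx₀
    intro i j hij
    exact congrArg (fun p : X × LevelBath d => p.2.1) hij
  -- Since `1 ≤ s x`, nothing lands on level `0`, which stays free for each of the infinitely many
  -- system states.
  have hgD : ((g '' {p : X × LevelBath d | p.1 ∈ f.Dom})ᶜ).Infinite := by
    refine Set.infinite_of_injective_forall_mem
      (f := fun x : X => ((x, ⟨0, ⟨0, hd 0⟩⟩) : X × LevelBath d)) ?_ ?_
    · intro x y hxy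
      exact congrArg Prod.fst hxy
    · rintro x ⟨⟨x', b⟩, hx', h⟩
      obtain ⟨y, hy⟩ := Part.dom_iff_mem.1 hx'
      have h1 := (hg x' y hy b).2.1
      rw [h] at h1
      have := hs x' hx'
      simp only at h1
      omega
  obtain ⟨E, hE⟩ := exists_equiv_extending hinj hD hgD
  refine ⟨E, fun x y hy b => ?_⟩
  rw [hE (x, b) (Part.dom_iff_mem.2 ⟨y, hy⟩)]
  exact ⟨(hg x y hy b).1, (hg x y hy b).2.1⟩

/-- The left side is an integer, so it suffices to bound it by `exp (θ j)` before rounding down;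
there the Kraft-type sum factors out. -/
theorem sum_floor_exp_le {X : Type*} {θ : ℝ} {s : X → ℕ} {j : ℕ} {F : Finset X}
    (hF : ∀ x ∈ F, s x ≤ j) (h : ∑ x ∈ F, Real.exp (-(θ * s x)) ≤ 1) :
    ∑ x ∈ F, ⌊Real.exp (θ * (j - s x : ℕ))⌋₊ ≤ ⌊Real.exp (θ * j)⌋₊ := by
  refine Nat.le_floor ?_
  push_cast
  calc ∑ x ∈ F, (⌊Real.exp (θ * (j - s x : ℕ))⌋₊ : ℝ)
      ≤ ∑ x ∈ F, Real.exp (θ * j) * Real.exp (-(θ * s x)) := by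
        refine Finset.sum_le_sum fun x hx => (Nat.floor_le (Real.exp_nonneg _)).trans_eq ?_
        rw [← Real.exp_add, Nat.cast_sub (hF x hx)]
        ring_nf
    _ = Real.exp (θ * j) * ∑ x ∈ F, Real.exp (-(θ * s x)) := by rw [Finset.mul_sum]
    _ ≤ Real.exp (θ * j) := mul_le_of_le_one_right (Real.exp_nonneg _) h

theorem summable_floor_exp_mul {θ a : ℝ} (ha : θ < a) (k : ℕ) :
    Summable fun j : ℕ => (⌊Real.exp (θ * j)⌋₊ : ℝ) * (Real.exp (-(a * j)) * (j : ℝ) ^ k) := by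
  refine Summable.of_nonneg_of_le (fun j => by positivity) (fun j => ?_)
    (Real.summable_pow_mul_exp_neg_nat_mul k (sub_pos.2 ha))
  calc (⌊Real.exp (θ * j)⌋₊ : ℝ) * (Real.exp (-(a * j)) * (j : ℝ) ^ k)
      ≤ Real.exp (θ * j) * (Real.exp (-(a * j)) * (j : ℝ) ^ k) := by
        gcongr
        exact Nat.floor_le (Real.exp_nonneg _)
    _ = (j : ℝ) ^ k * Real.exp (-(a - θ) * j) := by
        rw [← mul_assoc, ← Real.exp_add, mul_comm]
        ring_nf

/-- A process that shifts the bath from level `j` to level `j + s x` and thus has heat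
`kT * a * s x`. -/
theorem exists_process {X : Type} [Countable X] [Infinite X] {f : X →. X}
    (hf : ∃ x, x ∉ f.Dom) {kT θ a : ℝ} (hkT : 0 < kT) (hθ : 0 < θ) (ha : θ < a) {s : X → ℕ}
    (hs : ∀ x ∈ f.Dom, 1 ≤ s x)
    (hsum : ∀ y, ∀ F : Finset X, (∀ x ∈ F, y ∈ f x) → ∑ x ∈ F, Real.exp (-(θ * s x)) ≤ 1) :
    ∃ P : BathProcess X kT, (∀ x y, y ∈ f x → ∀ b, (P.evolve (x, b)).1 = y) ∧
      (∀ x ∈ f.Dom, Summable fun b => P.boltzmann b * P.energy (P.evolve (x, b)).2) ∧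
      ∀ x ∈ f.Dom, P.heat x = kT * a * s x := by
  -- The degeneracy grows at rate `θ`, the Boltzmann factor of energy `kT * a * j` decays at rate `a
  -- > θ`: the partition function and the mean energy converge.
  let d : ℕ → ℕ := fun j => ⌊Real.exp (θ * j)⌋₊
  have hd : ∀ j, 0 < d j := fun j => Nat.floor_pos.2 (Real.one_le_exp (by positivity))
  obtain ⟨e, he⟩ := exists_shift (f := f) (d := d) (s := s) hf hd hs fun y j F hF =>
    sum_floor_exp_le (fun x hx => (hF x hx).2) (hsum y F fun x hx => (hF x hx).1)
  have hw : ∀ b : LevelBath d, Real.exp (-(kT * a * b.1) / kT) = Real.exp (-(a * b.1)) := by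
    intro b
    congr 1
    field_simp
  have h0 : Summable fun b : LevelBath d => Real.exp (-(a * b.1)) := by
    refine summable_levelBath (w := fun j => Real.exp (-(a * j))) (fun j => by positivity) ?_
    simpa using summable_floor_exp_mul ha 0
  have h1 : Summable fun b : LevelBath d => Real.exp (-(a * b.1)) * (b.1 : ℝ) := by
    refine summable_levelBath (w := fun j => Real.exp (-(a * j)) * (j : ℝ))
      (fun j => by positivity) ?_
    simpa using summable_floor_exp_mul ha 1
  let P : BathProcess X kT :=
    { Bath := LevelBath d
      nonempty := ⟨⟨0, ⟨0, hd 0⟩⟩⟩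
      energy := fun b => kT * a * b.1
      evolve := e
      summable_boltzmann := by simpa only [hw] using h0
      summable_energy := by
        simp only [hw]
        refine (h1.mul_left (kT * a)).congr fun b => ?_
        ring }
  have hZ : 0 < ∑' b : LevelBath d, Real.exp (-(a * b.1)) :=
    h0.tsum_pos (fun b => (Real.exp_pos _).le) ⟨0, ⟨0, hd 0⟩⟩ (Real.exp_pos _)
  have hb : ∀ b : LevelBath d,
      P.boltzmann b = Real.exp (-(a * b.1)) / ∑' b : LevelBath d, Real.exp (-(a * b.1)) := by
    intro b
    simp only [BathProcess.boltzmann, P, hw]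
  have hB : HasSum P.boltzmann 1 := by
    have := h0.hasSum.div_const (∑' b : LevelBath d, Real.exp (-(a * b.1)))
    rw [div_self hZ.ne'] at this
    exact this.congr_fun hb
  have hE : Summable fun b : LevelBath d => P.boltzmann b * P.energy b := by
    refine ((h1.mul_left (kT * a)).div_const
      (∑' b : LevelBath d, Real.exp (-(a * b.1)))).congr fun b => ?_
    rw [hb]
    simp only [P]
    ring
  -- The energy gain does not depend on the initial bath state, so the mean gain is this constant.
  have hfin : ∀ x ∈ f.Dom, ∀ b : LevelBath d,
      P.boltzmann b * P.energy (P.evolve (x, b)).2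
        = P.boltzmann b * P.energy b + P.boltzmann b * (kT * a * s x) := by
    intro x hx b
    obtain ⟨y, hy⟩ := Part.dom_iff_mem.1 hx
    have := (he x y hy b).2
    simp only [P, this]
    push_cast
    ring
  have hS : Summable P.boltzmann := hB.summable
  refine ⟨P, fun x y hy b => (he x y hy b).1, fun x hx => ?_, fun x hx => ?_⟩
  · exact (hE.add (hS.mul_right _)).congr fun b => (hfin x hx b).symm
  · have : HasSum (fun b => P.boltzmann b * P.energy (P.evolve (x, b)).2)
        ((∑' b, P.boltzmann b * P.energy b) + 1 * (kT * a * s x)) :=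
      (hE.hasSum.add (hB.mul_right _)).congr_fun fun b => hfin x hx b
    rw [BathProcess.heat, this.tsum_eq]
    ring

/-- Every nonnegative heat function that obeys the Landauer-Kraft inequality on the fibers of `f`
is the heat function of a realization of `f`. -/
theorem exists_realization {X : Type} [Countable X] [Infinite X] {f : X →. X}
    (hf : ∃ x, x ∉ f.Dom) {kT : ℝ} (hkT : 0 < kT) {Q : X → ℝ} (hQ : ∀ x ∈ f.Dom, 0 ≤ Q x)
    (hsum : ∀ y, ∀ F : Finset X, (∀ x ∈ F, y ∈ f x) → ∑ x ∈ F, Real.exp (-(Q x / kT)) ≤ 1) :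
    ∃ R : Realization f kT, R.heat = Q := by
  let θ : ℕ → ℝ := fun n => 1 / ((n : ℝ) + 1)
  have hθ : ∀ n, 0 < θ n := fun n => by positivity
  -- Rounding up preserves the Kraft-type inequality; the extra `1` keeps level `0` free even where
  -- `Q x = 0`, and its cost `kT * θ n` vanishes in the limit.
  let s : ℕ → X → ℕ := fun n x => ⌈Q x / (kT * θ n)⌉₊ + 1
  have hlow : ∀ n x, Q x ≤ kT * θ n * s n x := by
    intro n x
    have h1 := Nat.le_ceil (Q x / (kT * θ n))
    rw [div_le_iff₀ (mul_pos hkT (hθ n))] at h1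
    simp only [s]
    push_cast
    nlinarith [mul_pos hkT (hθ n)]
  have hup : ∀ n, ∀ x ∈ f.Dom, kT * θ n * s n x ≤ Q x + 2 * (kT * θ n) := by
    intro n x hx
    have h1 := Nat.ceil_lt_add_one (div_nonneg (hQ x hx) (mul_pos hkT (hθ n)).le)
    have h2 := mul_le_mul_of_nonneg_left h1.le (mul_pos hkT (hθ n)).le
    rw [mul_add, mul_div_cancel₀ _ (mul_pos hkT (hθ n)).ne'] at h2
    simp only [s]
    push_cast
    linarith
  -- The rate `θ + θ ^ 2` strictly exceeds `θ`, as convergence of the partition function requires,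
  -- while its ratio to `θ` tends to `1`.
  have hP : ∀ n, ∃ P : BathProcess X kT, (∀ x y, y ∈ f x → ∀ b, (P.evolve (x, b)).1 = y) ∧
      (∀ x ∈ f.Dom, Summable fun b => P.boltzmann b * P.energy (P.evolve (x, b)).2) ∧
      ∀ x ∈ f.Dom, P.heat x = kT * (θ n + θ n ^ 2) * s n x := by
    intro n
    refine exists_process hf hkT (hθ n) (by have := hθ n; nlinarith) (fun x _ => by simp [s])
      fun y F hF => le_trans (Finset.sum_le_sum fun x hx => ?_) (hsum y F hF)
    rw [Real.exp_le_exp, neg_le_neg_iff, div_le_iff₀ hkT]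
    calc Q x ≤ kT * θ n * s n x := hlow n x
      _ = _ := by ring
  choose P h1 h2 h3 using hP
  refine ⟨⟨P, h1, h2, Q, fun x hx => ?_⟩, rfl⟩
  have hθ0 : Tendsto θ atTop (𝓝 0) := tendsto_one_div_add_atTop_nhds_zero_nat
  have hmid : Tendsto (fun n => kT * θ n * s n x) atTop (𝓝 (Q x)) := by
    refine tendsto_of_tendsto_of_tendsto_of_le_of_le tendsto_const_nhds
      (h := fun n => Q x + 2 * (kT * θ n)) ?_ (fun n => hlow n x) (fun n => hup n x hx)
    simpa using tendsto_const_nhds.add ((hθ0.const_mul kT).const_mul 2)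
  have : Tendsto (fun n => (1 + θ n) * (kT * θ n * s n x)) atTop (𝓝 ((1 + 0) * Q x)) :=
    (tendsto_const_nhds.add hθ0).mul hmid
  rw [add_zero, one_mul] at this
  refine this.congr fun n => ?_
  rw [h3 n x hx]
  ring

end Bath

/-! ### Existence of coin-flipping realizations -/

namespace PrefixMachine

variable (M : PrefixMachine)

theorem coinInput_le_coinOutput {x y : List Bool} (h : y ∈ M.φ x) :
    M.coinInput x ≤ M.coinOutput y := by
  rw [coinInput, coinOutput, mX_of_mem _ (mem_dom h)]
  exact div_le_div_of_nonneg_right (M.pow_le_mY h) M.haltingProb_nonneg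

theorem exists_coinFlipping {kT : ℝ} (hkT : 0 < kT) :
    ∃ R : Realization M.φ kT, M.IsCoinFlipping R := by
  classical
  let Q : List Bool → ℝ := fun x => if hx : (M.φ x).Dom then
    kT * (-Real.log (M.coinInput x) + Real.log (M.coinOutput ((M.φ x).get hx))) else 0
  have hQ : ∀ x y, y ∈ M.φ x →
      Q x = kT * (-Real.log (M.coinInput x) + Real.log (M.coinOutput y)) := by
    rintro x y ⟨hx, rfl⟩
    simp only [Q, hx, dif_pos]
  suffices h : ∃ R : Realization M.φ kT, R.heat = Q by
    obtain ⟨R, hR⟩ := h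
    exact ⟨R, fun x y h => by rw [hR, hQ x y h]⟩
  refine exists_realization M.exists_notMem_dom hkT ?_ ?_
  · intro x hx
    obtain ⟨y, hy⟩ := Part.dom_iff_mem.1 hx
    rw [hQ x y hy]
    have := Real.log_le_log (M.coinInput_pos hx) (M.coinInput_le_coinOutput hy)
    exact mul_nonneg hkT.le (by linarith)
  · intro y F hF
    rcases F.eq_empty_or_nonempty with rfl | ⟨x₀, hx₀⟩
    · simp
    have hy := M.mY_pos (hF x₀ hx₀)
    have hΩ := M.haltingProb_pos ⟨x₀, mem_dom (hF x₀ hx₀)⟩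
    -- The halting probability cancels, and the terms are the conditional probabilities of the
    -- inputs given the output.
    have h1 : ∀ x ∈ F, Real.exp (-(Q x / kT)) = (1 / 2 : ℝ) ^ x.length / M.mY y := by
      intro x hx
      have hx' := hF x hx
      rw [hQ x y hx', mul_div_cancel_left₀ _ hkT.ne', neg_add, neg_neg, ← sub_eq_add_neg,
        Real.exp_sub, Real.exp_log (M.coinInput_pos (mem_dom hx')),
        Real.exp_log (M.coinOutput_pos hx'), coinInput, coinOutput, mX_of_mem _ (mem_dom hx'),
        div_div_div_cancel_right₀ hΩ.ne']
    rw [Finset.sum_congr rfl h1, ← Finset.sum_div, div_le_one hy]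
    exact M.sum_fiber_le hF

end PrefixMachine
-- Entropy production of finitely supported distributions
section EntropyProduction

variable {X : Type} {f : X →. X} {kT : ℝ}

open Classical in
theorem outputDist_eq_sum {p : X → ℝ} {F : Finset X} (hp : ∀ x, x ∉ F → p x = 0) (y : X) :
    outputDist f p y = ∑ x ∈ F with y ∈ f x, p x := by
  have h := tsum_subtype {x | y ∈ f x} p
  have h2 : ∑' x, Set.indicator {x | y ∈ f x} p x
      = ∑ x ∈ F, Set.indicator {x | y ∈ f x} p x :=
    tsum_eq_sum fun x hx => Set.indicator_apply_eq_zero.2 fun _ => hp x hx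
  rw [Finset.sum_filter]
  refine (h.trans h2).trans (Finset.sum_congr rfl fun x _ => ?_)
  simp [Set.indicator_apply]

/-- Entropy production of a finitely supported input distribution, as a relative entropy. -/
theorem entropyProduction_eq_sum (R : Realization f kT) {p : X → ℝ} {F : Finset X}
    (hp : ∀ x, x ∉ F → p x = 0) {g : X → X} (hg : ∀ x ∈ F, g x ∈ f x) :
    R.entropyProduction p = ∑ x ∈ F, p x *
      (Real.log (p x) - Real.log (outputDist f p (g x)) + R.heat x / kT) := by
  classical
  have hmem : ∀ x ∈ F, ∀ y, y ∈ f x ↔ g x = y := fun x hx y =>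
    ⟨fun h => Part.mem_unique (hg x hx) h, fun h => h ▸ hg x hx⟩
  have h1 : shannonEntropy p = ∑ x ∈ F, -(p x * Real.log (p x)) := by
    rw [shannonEntropy, tsum_eq_sum (s := F) fun x hx => by simp [hp x hx]]
    simp [Real.negMulLog]
  have h2 : shannonEntropy (outputDist f p)
      = ∑ x ∈ F, -(p x * Real.log (outputDist f p (g x))) := by
    rw [shannonEntropy, tsum_eq_sum (s := F.image g)]
    · rw [← Finset.sum_fiberwise_of_maps_to (g := g) (t := F.image g)
        fun x hx => Finset.mem_image_of_mem g hx]
      refine Finset.sum_congr rfl fun y _ => ?_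
      have h3 : ∑ x ∈ F with g x = y, -(p x * Real.log (outputDist f p (g x)))
          = ∑ x ∈ F with g x = y, p x * -Real.log (outputDist f p y) :=
        Finset.sum_congr rfl fun x hx => by rw [(Finset.mem_filter.1 hx).2, mul_neg]
      rw [h3, ← Finset.sum_mul, ← Finset.filter_congr fun x hx => hmem x hx y,
        ← outputDist_eq_sum hp, Real.negMulLog]
      ring
    · intro y hy
      rw [outputDist_eq_sum hp, Finset.filter_eq_empty_iff.2]
      · simp
      · intro x hx hxy
        exact hy (Finset.mem_image.2 ⟨x, hx, (hmem x hx y).1 hxy⟩)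
  have h3 : (∑' x, p x * R.heat x) / kT = ∑ x ∈ F, p x * (R.heat x / kT) := by
    rw [tsum_eq_sum (s := F) fun x hx => by simp [hp x hx], Finset.sum_div]
    exact Finset.sum_congr rfl fun x _ => by ring
  rw [Realization.entropyProduction, h1, h2, h3, ← Finset.sum_sub_distrib,
    ← Finset.sum_add_distrib]
  exact Finset.sum_congr rfl fun x _ => by ring

end EntropyProduction

/-! ### Reversibility on the coin-flipping distribution -/

namespace PrefixMachine

variable (M : PrefixMachine) {kT : ℝ}

theorem summable_coin_fiber (y : List Bool) :
    Summable fun x : {x : List Bool // y ∈ M.φ x} => M.coinInput x :=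
  M.summable_coinInput.subtype {x | y ∈ M.φ x}

theorem coinOutput_eq_tsum (y : List Bool) :
    M.coinOutput y = ∑' x : {x : List Bool // y ∈ M.φ x}, M.coinInput x :=
  (congrFun M.outputDist_coinInput y).symm

/-- The inputs, sorted by their outputs. -/
abbrev Fibers : Type := Σ y, {x : List Bool // y ∈ M.φ x}

/-- Each halting input has exactly one output, so sorting by outputs is a reindexing of the domain;
this gives access to iterated sums over outputs and fibers. -/
theorem hasSum_fibers_iff {w : List Bool → ℝ} (hw : ∀ x, x ∉ M.φ.Dom → w x = 0) {a : ℝ} :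
    HasSum (fun p : M.Fibers => w p.2) a ↔ HasSum w a := by
  have hι : Function.Injective (fun p : M.Fibers => p.2.1) := by
    rintro ⟨y, x, h⟩ ⟨y', x', h'⟩ (rfl : x = x')
    obtain rfl := Part.mem_unique h h'
    rfl
  refine hι.hasSum_iff fun x hx => hw x fun hd => hx ?_
  obtain ⟨y, hy⟩ := Part.dom_iff_mem.1 hd
  exact ⟨⟨y, x, hy⟩, rfl⟩

theorem hasSum_mY : HasSum M.mY M.haltingProb := by
  have h1 := (M.hasSum_fibers_iff fun x hx => if_neg hx).2 M.hasSum_mX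
  refine h1.sigma fun y => (M.summable_fiber y).hasSum.congr_fun fun x => ?_
  exact M.mX_of_mem (mem_dom x.2)

theorem hasSum_coinOutput (h : M.φ.Dom.Nonempty) : HasSum M.coinOutput 1 := by
  have := M.hasSum_mY.div_const M.haltingProb
  rwa [div_self (M.haltingProb_pos h).ne'] at this

theorem coinOutput_nonneg (y : List Bool) : 0 ≤ M.coinOutput y :=
  div_nonneg (M.mY_nonneg y) M.haltingProb_nonneg

theorem coinOutput_le_one {x y : List Bool} (h : y ∈ M.φ x) : M.coinOutput y ≤ 1 :=
  le_hasSum (M.hasSum_coinOutput ⟨x, mem_dom h⟩) y fun _ _ => M.coinOutput_nonneg _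

theorem finite_entropy {R : Realization M.φ kT} (hkT : kT ≠ 0) (hR : M.IsCoinFlipping R)
    (hS : Summable fun x => Real.negMulLog (M.coinInput x)) :
    Summable (fun y => Real.negMulLog (outputDist M.φ M.coinInput y)) ∧
      Summable (fun x => M.coinInput x * R.heat x) ∧ R.entropyProduction M.coinInput = 0 := by
  have hw0 : ∀ x, x ∉ M.φ.Dom → Real.negMulLog (M.coinInput x) = 0 := fun x hx => by
    rw [M.coinInput_eq_zero hx, Real.negMulLog_zero]
  have hq0 : ∀ x, x ∉ M.φ.Dom → M.coinInput x * R.heat x = 0 := fun x hx => by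
    rw [M.coinInput_eq_zero hx, zero_mul]
  have hW := (M.hasSum_fibers_iff hw0).2 hS.hasSum
  have hV : Summable fun p : M.Fibers => M.coinInput p.2 * -Real.log (M.coinOutput p.1) := by
    -- An output is at least as likely as each of its inputs, so `-ln p_Y ≤ -ln p_X` and the input
    -- entropy dominates.
    refine Summable.of_nonneg_of_le (fun p => ?_) (fun p => ?_) hW.summable
    · exact mul_nonneg (M.coinInput_nonneg _) (neg_nonneg.2
        (Real.log_nonpos (M.coinOutput_nonneg _) (M.coinOutput_le_one p.2.2)))
    · rw [Real.negMulLog, neg_mul, ← mul_neg]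
      exact mul_le_mul_of_nonneg_left (neg_le_neg (Real.log_le_log
        (M.coinInput_pos (mem_dom p.2.2)) (M.coinInput_le_coinOutput p.2.2)))
        (M.coinInput_nonneg _)
  have hO : HasSum (fun y => Real.negMulLog (M.coinOutput y))
      (∑' p : M.Fibers, M.coinInput p.2 * -Real.log (M.coinOutput p.1)) := by
    refine hV.hasSum.sigma fun y => ?_
    have := (M.summable_coin_fiber y).hasSum.mul_right (-Real.log (M.coinOutput y))
    rw [← coinOutput_eq_tsum] at this
    rwa [Real.negMulLog, neg_mul, ← mul_neg]
  have hQ : HasSum (fun x => M.coinInput x * R.heat x)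
      (kT * (∑' x, Real.negMulLog (M.coinInput x)
        - ∑' p : M.Fibers, M.coinInput p.2 * -Real.log (M.coinOutput p.1))) := by
    rw [← M.hasSum_fibers_iff hq0]
    refine ((hW.sub hV.hasSum).mul_left kT).congr_fun fun p => ?_
    rw [hR p.2 p.1 p.2.2, Real.negMulLog]
    ring
  rw [Realization.entropyProduction, shannonEntropy, shannonEntropy, outputDist_coinInput,
    hO.tsum_eq, hQ.tsum_eq, mul_div_cancel_left₀ _ hkT]
  exact ⟨hO.summable, hQ.summable, by ring⟩

theorem entropyProduction_condOn_mem_Icc {R : Realization M.φ kT} (hkT : kT ≠ 0)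
    (hR : M.IsCoinFlipping R) {F : Finset (List Bool)} (hF : 0 < ∑ x ∈ F, M.coinInput x) :
    R.entropyProduction (condOn M.coinInput F) ∈
      Set.Icc 0 (1 / (∑ x ∈ F, M.coinInput x) - 1) := by
  classical
  set P := ∑ x ∈ F, M.coinInput x
  set p := condOn M.coinInput F with hp
  set q := outputDist M.φ p
  -- Inputs in `F` outside the domain have probability zero, and the heat is unspecified there; they
  -- are discarded.
  let G := F.filter fun x => x ∈ M.φ.Dom
  have hG : ∀ x ∈ G, x ∈ F ∧ x ∈ M.φ.Dom := fun x hx => Finset.mem_filter.1 hx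
  have hpG : ∀ x ∈ G, p x = M.coinInput x / P := fun x hx => if_pos (hG x hx).1
  have hp0 : ∀ x, x ∉ G → p x = 0 := by
    intro x hx
    by_cases hxF : x ∈ F
    · have : x ∉ M.φ.Dom := fun h => hx (Finset.mem_filter.2 ⟨hxF, h⟩)
      simp [hp, condOn, M.coinInput_eq_zero this]
    · exact if_neg hxF
  have hg : ∀ x, ∃ y, x ∈ G → y ∈ M.φ x := by
    intro x
    by_cases hx : x ∈ G
    · obtain ⟨y, hy⟩ := Part.dom_iff_mem.1 (hG x hx).2
      exact ⟨y, fun _ => hy⟩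
    · exact ⟨[], fun h => absurd h hx⟩
  choose g hg using hg
  have hppos : ∀ x ∈ G, 0 < p x := fun x hx => by
    rw [hpG x hx]
    exact div_pos (M.coinInput_pos (hG x hx).2) hF
  have hpnn : ∀ x, 0 ≤ p x := fun x => by
    by_cases hx : x ∈ G
    · exact (hppos x hx).le
    · exact (hp0 x hx).ge
  have hqsum : ∀ y, q y = ∑ x ∈ G with y ∈ M.φ x, p x := outputDist_eq_sum hp0
  have hqpos : ∀ x ∈ G, 0 < q (g x) := fun x hx => by
    rw [hqsum]
    exact lt_of_lt_of_le (hppos x hx) (Finset.single_le_sum (f := p) (fun z _ => hpnn z)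
      (Finset.mem_filter.2 ⟨hx, hg x hx⟩))
  -- `P * q y` is the part of the output probability of `y` that comes from inputs in `F`.
  have hqle : ∀ y, P * q y ≤ M.coinOutput y := by
    intro y
    rw [hqsum, Finset.mul_sum, coinOutput_eq_tsum]
    have h1 : ∑ x ∈ G with y ∈ M.φ x, P * p x = ∑ x ∈ G with y ∈ M.φ x, M.coinInput x :=
      Finset.sum_congr rfl fun x hx => by
        rw [hpG x (Finset.mem_filter.1 hx).1, mul_div_cancel₀ _ hF.ne']
    have h2 := (M.summable_coin_fiber y).sum_le_tsum
      ((G.filter fun x => y ∈ M.φ x).subtype fun x => y ∈ M.φ x) fun x _ => M.coinInput_nonneg _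
    rw [Finset.sum_subtype_of_mem _ fun x hx => (Finset.mem_filter.1 hx).2] at h2
    rw [h1]
    exact h2
  have hone : ∑ x ∈ G, p x = 1 := by
    have h1 : ∑ x ∈ F, M.coinInput x = ∑ x ∈ G, M.coinInput x :=
      (Finset.sum_filter_of_ne fun x _ h => by
        by_contra hx
        exact h (M.coinInput_eq_zero hx)).symm
    rw [Finset.sum_congr rfl hpG, ← Finset.sum_div, ← h1, div_self hF.ne']
  have hEP : R.entropyProduction p
      = ∑ x ∈ G, p x * Real.log (M.coinOutput (g x) / (P * q (g x))) := by
    rw [entropyProduction_eq_sum R hp0 hg]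
    refine Finset.sum_congr rfl fun x hx => ?_
    have hc := (M.coinInput_pos (hG x hx).2).ne'
    rw [hR x (g x) (hg x hx), mul_div_cancel_left₀ _ hkT,
      Real.log_div (M.coinOutput_pos (hg x hx)).ne' (mul_pos hF (hqpos x hx)).ne',
      Real.log_mul hF.ne' (hqpos x hx).ne']
    nth_rewrite 2 [hpG x hx]
    rw [Real.log_div hc hF.ne']
    ring
  rw [hEP]
  constructor
  · refine Finset.sum_nonneg fun x hx => mul_nonneg (hpnn x) (Real.log_nonneg ?_)
    rw [one_le_div (mul_pos hF (hqpos x hx))]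
    exact hqle _
  -- For the upper bound `ln t ≤ t - 1` is used: summed over a fiber, the factor `q` cancels and
  -- `p_Y / P` remains.
  · have hfib : ∑ x ∈ G, p x * (M.coinOutput (g x) / (P * q (g x)))
        = ∑ y ∈ G.image g, M.coinOutput y / P := by
      rw [← Finset.sum_fiberwise_of_maps_to (g := g) (t := G.image g)
        fun x hx => Finset.mem_image_of_mem g hx]
      refine Finset.sum_congr rfl fun y hy => ?_
      obtain ⟨x₀, hx₀, rfl⟩ := Finset.mem_image.1 hy
      have h3 : ∑ x ∈ G with g x = g x₀, p x * (M.coinOutput (g x) / (P * q (g x)))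
          = ∑ x ∈ G with g x = g x₀, p x * (M.coinOutput (g x₀) / (P * q (g x₀))) :=
        Finset.sum_congr rfl fun x hx => by rw [(Finset.mem_filter.1 hx).2]
      have h4 : ∑ x ∈ G with g x = g x₀, p x = q (g x₀) := by
        rw [hqsum]
        refine Finset.sum_congr (Finset.filter_congr fun x hx => ?_) fun _ _ => rfl
        exact ⟨fun h => h ▸ hg x hx, fun h => Part.mem_unique (hg x hx) h⟩
      rw [h3, ← Finset.sum_mul, h4]
      have := (hqpos x₀ hx₀).ne'
      field_simp
    have hne : M.φ.Dom.Nonempty := by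
      rcases G.eq_empty_or_nonempty with h | ⟨x, hx⟩
      · simp [h] at hone
      · exact ⟨x, (hG x hx).2⟩
    calc ∑ x ∈ G, p x * Real.log (M.coinOutput (g x) / (P * q (g x)))
        ≤ ∑ x ∈ G, p x * (M.coinOutput (g x) / (P * q (g x)) - 1) := by
          refine Finset.sum_le_sum fun x hx => mul_le_mul_of_nonneg_left ?_ (hpnn x)
          exact Real.log_le_sub_one_of_pos
            (div_pos (M.coinOutput_pos (hg x hx)) (mul_pos hF (hqpos x hx)))
      _ = (∑ y ∈ G.image g, M.coinOutput y) / P - 1 := by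
          simp only [mul_sub, mul_one]
          rw [Finset.sum_sub_distrib, hfib, hone, Finset.sum_div]
      _ ≤ 1 / P - 1 := by
          gcongr
          exact sum_le_hasSum _ (fun y _ => M.coinOutput_nonneg y) (M.hasSum_coinOutput hne)

theorem hasEntropyProduction_coinInput {R : Realization M.φ kT} (hkT : kT ≠ 0)
    (hR : M.IsCoinFlipping R) : R.HasEntropyProduction M.coinInput 0 := by
  -- For an empty domain `p_X` vanishes identically, and so does every conditioned entropy
  -- production.
  rcases M.φ.Dom.eq_empty_or_nonempty with h | h
  · have h0 : M.coinInput = fun _ => 0 := by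
      ext x
      exact M.coinInput_eq_zero (by simp [h])
    refine tendsto_const_nhds.congr fun F => ?_
    rw [entropyProduction_eq_sum R (F := ∅) (g := id)]
    · simp
    · simp [h0, condOn]
    · simp
  · have h1 : Tendsto (fun F : Finset (List Bool) => ∑ x ∈ F, M.coinInput x) atTop (𝓝 1) :=
      M.hasSum_coinInput h
    have h2 := (h1.eventually (lt_mem_nhds zero_lt_one)).mono fun F hF =>
      M.entropyProduction_condOn_mem_Icc hkT hR hF
    refine tendsto_of_tendsto_of_tendsto_of_le_of_le' tendsto_const_nhds ?_
      (h2.mono fun F hF => hF.1) (h2.mono fun F hF => hF.2)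
    simpa using ((tendsto_const_nhds (x := (1 : ℝ))).div h1 one_ne_zero).sub_const 1

end PrefixMachine
-- Binary expansions
section Binary

/-- The number with binary expansion `z`, most significant digit first. -/
def binVal (z : List Bool) : ℕ := z.foldl (fun a b => 2 * a + b.toNat) 0

theorem binVal_concat (z : List Bool) (b : Bool) : binVal (z ++ [b]) = 2 * binVal z + b.toNat := by
  simp [binVal]

/-- In terms of dyadic intervals: the interval of an extension of `x` lies inside the interval of
`x`. -/
theorem binVal_append (x w : List Bool) :
    binVal x * 2 ^ w.length ≤ binVal (x ++ w) ∧
      binVal (x ++ w) < (binVal x + 1) * 2 ^ w.length := by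
  induction w using List.reverseRecOn with
  | nil => simp
  | append_singleton w b ih =>
    rw [← List.append_assoc, binVal_concat, List.length_append, List.length_singleton, pow_succ]
    have : b.toNat ≤ 1 := Bool.toNat_le b
    constructor
    · nlinarith [ih.1]
    · nlinarith [ih.2]

theorem exists_binVal (n a : ℕ) (h : a < 2 ^ n) : ∃ z, z.length = n ∧ binVal z = a := by
  induction n generalizing a with
  | zero => exact ⟨[], rfl, by simp [binVal]; omega⟩
  | succ n ih =>
    obtain ⟨z, hz, hv⟩ := ih (a / 2) (by rw [pow_succ] at h; omega)
    refine ⟨z ++ [decide (a % 2 = 1)], by simp [hz], ?_⟩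
    rw [binVal_concat, hv]
    by_cases h1 : a % 2 = 1
    · simp [h1]; omega
    · simp [h1]; omega

theorem primrec_binVal : Primrec binVal := by
  have h : Primrec₂ fun (_ : List Bool) (q : ℕ × Bool) => 2 * q.1 + q.2.toNat :=
    Primrec.nat_add.comp (Primrec.nat_mul.comp (Primrec.const 2)
      (Primrec.fst.comp Primrec.snd))
      ((Primrec.dom_bool Bool.toNat).comp (Primrec.snd.comp Primrec.snd))
  exact Primrec.list_foldl Primrec.id (Primrec.const 0) h

theorem primrec₂_pow : Primrec₂ ((· ^ ·) : ℕ → ℕ → ℕ) := Primrec₂.unpaired'.1 Nat.Primrec.pow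

end Binary

/-! ### Online allocation of codewords (Kraft-Chaitin) -/

section Allocation

/-- The least `a` with `p.1 / 2 ^ p.2 ≤ a / 2 ^ n`. -/
def ceilAt (p : ℕ × ℕ) (n : ℕ) : ℕ := (p.1 * 2 ^ n + (2 ^ p.2 - 1)) / 2 ^ p.2

theorem primrec₂_ceilAt : Primrec₂ ceilAt := by
  have h2 : Primrec fun q : (ℕ × ℕ) × ℕ => 2 ^ q.1.2 :=
    primrec₂_pow.comp (Primrec.const 2) (Primrec.snd.comp Primrec.fst)
  refine Primrec.nat_div.comp (Primrec.nat_add.comp (Primrec.nat_mul.comp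
    (Primrec.fst.comp Primrec.fst) (primrec₂_pow.comp (Primrec.const 2) Primrec.snd)) ?_) h2
  exact Primrec.nat_sub.comp h2 (Primrec.const 1)

/-- The dyadic rational `p.1 / 2 ^ p.2`. -/
noncomputable def dyadic (p : ℕ × ℕ) : ℝ := p.1 / 2 ^ p.2

theorem dyadic_le_ceilAt (p : ℕ × ℕ) (n : ℕ) : dyadic p ≤ ceilAt p n / 2 ^ n := by
  have h0 : 0 < 2 ^ p.2 := by positivity
  have h : p.1 * 2 ^ n ≤ ceilAt p n * 2 ^ p.2 := by
    have h1 := Nat.div_add_mod (p.1 * 2 ^ n + (2 ^ p.2 - 1)) (2 ^ p.2)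
    have h2 := Nat.mod_lt (p.1 * 2 ^ n + (2 ^ p.2 - 1)) h0
    have h3 : ceilAt p n * 2 ^ p.2 = 2 ^ p.2 * ((p.1 * 2 ^ n + (2 ^ p.2 - 1)) / 2 ^ p.2) :=
      mul_comm _ _
    omega
  rw [dyadic, div_le_div_iff₀ (by positivity) (by positivity)]
  exact_mod_cast h

theorem ceilAt_le (p : ℕ × ℕ) (n : ℕ) : (ceilAt p n : ℝ) / 2 ^ n ≤ dyadic p + (1 / 2) ^ n := by
  have h0 : 0 < 2 ^ p.2 := by positivity
  have h : ceilAt p n * 2 ^ p.2 ≤ p.1 * 2 ^ n + 2 ^ p.2 :=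
    (Nat.div_mul_le_self _ _).trans (by omega)
  have h' : (ceilAt p n : ℝ) * 2 ^ p.2 ≤ p.1 * 2 ^ n + 2 ^ p.2 := by exact_mod_cast h
  rw [dyadic, one_div_pow, div_add_div _ _ (by positivity) (by positivity),
    div_le_div_iff₀ (by positivity) (by positivity)]
  nlinarith [pow_pos (two_pos (α := ℝ)) n]

/-- The left end of the free part of `[0, 1)` after a request has been served, if it was `p`
before. -/
def serve (p : ℕ × ℕ) (r : ℕ × List Bool) : ℕ × ℕ := (ceilAt p r.1 + 1, r.1)

/-- The left end of the free part of `[0, 1)`, as a dyadic rational, after the first `i` requests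
have been served. -/
def freeFrom (req : ℕ → Option (ℕ × List Bool)) (i : ℕ) : ℕ × ℕ :=
  Nat.rec (0, 0) (fun j p => ((req j).map (serve p)).getD p) i

variable {req : ℕ → Option (ℕ × List Bool)}

theorem freeFrom_succ_none {i : ℕ} (h : req i = none) :
    freeFrom req (i + 1) = freeFrom req i := by
  simp [freeFrom, h]

theorem freeFrom_succ_some {i n : ℕ} {y : List Bool} (h : req i = some (n, y)) :
    freeFrom req (i + 1) = (ceilAt (freeFrom req i) n + 1, n) := by
  simp [freeFrom, serve, h]

/-- The weight `2 ^ (-n)` of a request for a codeword of length `n`. -/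
noncomputable def requestWeight (r : Option (ℕ × List Bool)) : ℝ :=
  r.elim 0 fun p => (1 / 2) ^ p.1

theorem dyadic_freeFrom_mono : Monotone fun i => dyadic (freeFrom req i) := by
  refine monotone_nat_of_le_succ fun i => ?_
  rcases h : req i with _ | ⟨n, y⟩
  · rw [freeFrom_succ_none h]
  · rw [freeFrom_succ_some h]
    refine (dyadic_le_ceilAt _ n).trans ?_
    simp only [dyadic]
    gcongr
    simp

/-- Serving a request of length `n` uses an interval of length `2 ^ (-n)` and wastes at most as much
in aligning its left end. This accounts for the factor `2`, and for the budget `1 / 2` instead of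
`1` later on. -/
theorem dyadic_freeFrom_le (i : ℕ) :
    dyadic (freeFrom req i) ≤ 2 * ∑ j ∈ Finset.range i, requestWeight (req j) := by
  induction i with
  | zero => simp [dyadic, freeFrom]
  | succ i ih =>
    rw [Finset.sum_range_succ]
    rcases h : req i with _ | ⟨n, y⟩
    · rw [freeFrom_succ_none h]
      simpa [requestWeight] using ih
    · rw [freeFrom_succ_some h]
      have h1 := ceilAt_le (freeFrom req i) n
      simp only [requestWeight, Option.elim_some]
      have h2 : dyadic (ceilAt (freeFrom req i) n + 1, n)
          = (ceilAt (freeFrom req i) n : ℝ) / 2 ^ n + (1 / 2) ^ n := by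
        simp only [dyadic]
        push_cast
        rw [add_div, one_div_pow]
      rw [h2]
      unfold requestWeight at ih
      linarith

/-- The output of the request `q.2` if `q.1.1` is the codeword allocated to it when the free part
begins at `q.1.2`. -/
def allocTest (q : (List Bool × (ℕ × ℕ)) × (ℕ × List Bool)) : Option (List Bool) :=
  if q.1.1.length = q.2.1 ∧ binVal q.1.1 = ceilAt q.1.2 q.2.1 then some q.2.2 else none

/-- The output of the `i`-th request if `z` is the codeword allocated to it. -/
def allocated (req : ℕ → Option (ℕ × List Bool)) (z : List Bool) (i : ℕ) : Option (List Bool) :=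
  (req i).bind fun r => allocTest ((z, freeFrom req i), r)

theorem allocated_eq_some {z y : List Bool} {i : ℕ} :
    allocated req z i = some y ↔
      req i = some (z.length, y) ∧ binVal z = ceilAt (freeFrom req i) z.length := by
  simp only [allocated, allocTest, Option.bind_eq_some_iff, Option.ite_none_right_eq_some,
    Option.some.injEq, Prod.exists]
  constructor
  · rintro ⟨n, y, h, ⟨rfl, h2⟩, rfl⟩
    exact ⟨h, h2⟩
  · rintro ⟨h, h2⟩
    exact ⟨_, _, h, ⟨rfl, h2⟩, rfl⟩

/-- Comparable codewords have nested intervals, whereas the intervals given to different requests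
are disjoint because the free part only moves to the right. -/
theorem allocated_disjoint {z z' y y' : List Bool} {i i' : ℕ} (h : allocated req z i = some y)
    (h' : allocated req z' i' = some y') (hz : z <+: z') : i = i' := by
  rw [allocated_eq_some] at h h'
  obtain ⟨w, rfl⟩ := hz
  have hw := binVal_append z w
  have e1 : ((binVal z : ℝ)) / 2 ^ z.length ≤ binVal (z ++ w) / 2 ^ (z ++ w).length := by
    rw [div_le_div_iff₀ (by positivity) (by positivity), List.length_append]
    have := Nat.mul_le_mul_right (2 ^ z.length) hw.1
    rw [mul_assoc, ← pow_add, add_comm w.length] at this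
    exact_mod_cast this
  have e2 : (binVal (z ++ w) : ℝ) / 2 ^ (z ++ w).length < (binVal z + 1) / 2 ^ z.length := by
    rw [div_lt_div_iff₀ (by positivity) (by positivity), List.length_append]
    have := Nat.mul_lt_mul_of_pos_right hw.2 (show 0 < 2 ^ z.length by positivity)
    rw [mul_assoc, ← pow_add, add_comm w.length] at this
    exact_mod_cast this
  have d1 := dyadic_le_ceilAt (freeFrom req i) z.length
  have d2 := dyadic_le_ceilAt (freeFrom req i') (z ++ w).length
  rw [← h.2] at d1
  rw [← h'.2] at d2
  have s1 := freeFrom_succ_some h.1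
  have s2 := freeFrom_succ_some h'.1
  rw [← h.2] at s1
  rw [← h'.2] at s2
  rcases lt_trichotomy i i' with hlt | heq | hlt
  · have hm := dyadic_freeFrom_mono (req := req) (Nat.succ_le_of_lt hlt)
    simp only [Nat.succ_eq_add_one, s1] at hm
    have : dyadic (binVal z + 1, z.length) = (binVal z + 1 : ℝ) / 2 ^ z.length := by
      simp [dyadic]
    linarith
  · exact heq
  · have hm := dyadic_freeFrom_mono (req := req) (Nat.succ_le_of_lt hlt)
    simp only [Nat.succ_eq_add_one, s2] at hm
    have : dyadic (binVal (z ++ w) + 1, (z ++ w).length)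
        = (binVal (z ++ w) : ℝ) / 2 ^ (z ++ w).length + 1 / 2 ^ (z ++ w).length := by
      simp [dyadic, add_div]
    have : (0 : ℝ) < 1 / 2 ^ (z ++ w).length := by positivity
    linarith

theorem primrec₂_serve : Primrec₂ serve := by
  have hn : Primrec fun a : (ℕ × ℕ) × (ℕ × List Bool) => a.2.1 := Primrec.fst.comp Primrec.snd
  exact Primrec.pair (Primrec.succ.comp (primrec₂_ceilAt.comp Primrec.fst hn)) hn

theorem computable_freeFrom (hreq : Computable req) : Computable (freeFrom req) := by
  have hstep : Computable₂ fun (_ : ℕ) (q : ℕ × (ℕ × ℕ)) =>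
      ((req q.1).map (serve q.2)).getD q.2 := by
    have hq : Computable fun a : ℕ × (ℕ × (ℕ × ℕ)) => a.2.2 :=
      Computable.snd.comp Computable.snd
    have hr : Computable fun a : ℕ × (ℕ × (ℕ × ℕ)) => req a.2.1 :=
      hreq.comp (Computable.fst.comp Computable.snd)
    have hs : Computable₂ fun (a : ℕ × (ℕ × (ℕ × ℕ))) (r : ℕ × List Bool) => serve a.2.2 r :=
      primrec₂_serve.to_comp.comp (hq.comp Computable.fst) Computable.snd
    exact Computable.option_getD (Computable.option_map hr hs) hq
  exact (Computable.nat_rec Computable.id (Computable.const ((0, 0) : ℕ × ℕ)) hstep).of_eq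
    fun i => rfl

theorem primrec_allocTest : Primrec allocTest := by
  have hz : Primrec fun a : (List Bool × (ℕ × ℕ)) × (ℕ × List Bool) => a.1.1 :=
    Primrec.fst.comp Primrec.fst
  have hn : Primrec fun a : (List Bool × (ℕ × ℕ)) × (ℕ × List Bool) => a.2.1 :=
    Primrec.fst.comp Primrec.snd
  have h1 : PrimrecPred fun a : (List Bool × (ℕ × ℕ)) × (ℕ × List Bool) =>
      a.1.1.length = a.2.1 := Primrec.eq.comp (Primrec.list_length.comp hz) hn
  have h2 : PrimrecPred fun a : (List Bool × (ℕ × ℕ)) × (ℕ × List Bool) =>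
      binVal a.1.1 = ceilAt a.1.2 a.2.1 := Primrec.eq.comp (primrec_binVal.comp hz)
        (primrec₂_ceilAt.comp (Primrec.snd.comp Primrec.fst) hn)
  exact Primrec.ite (h1.and h2) (Primrec.option_some.comp (Primrec.snd.comp Primrec.snd))
    (Primrec.const none)

theorem computable₂_allocated (hreq : Computable req) : Computable₂ (allocated req) := by
  have h1 : Computable fun a : List Bool × ℕ => (a.1, freeFrom req a.2) :=
    Computable.pair Computable.fst ((computable_freeFrom hreq).comp Computable.snd)
  have h2 : Computable₂ fun (a : List Bool × ℕ) (r : ℕ × List Bool) =>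
      allocTest ((a.1, freeFrom req a.2), r) :=
    primrec_allocTest.to_comp.comp (Computable.pair (h1.comp Computable.fst) Computable.snd)
  exact Computable.option_bind (hreq.comp Computable.snd) h2

/-- A Kraft-Chaitin theorem: computable requests for codewords, of total weight at most `1 / 2`,
are served by a prefix machine. -/
theorem exists_prefixMachine_of_requests (hreq : Computable req)
    (hsum : ∀ N, ∑ i ∈ Finset.range N, requestWeight (req i) ≤ 1 / 2) :
    ∃ V : PrefixMachine, ∀ i n y, req i = some (n, y) → ∃ z, z.length = n ∧ y ∈ V.φ z := by
  let V : PrefixMachine :=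
    { φ := fun z => Nat.rfindOpt (allocated req z)
      partrec := Partrec.rfindOpt (computable₂_allocated hreq)
      prefixFree := by
        intro x hx x' hx' h
        obtain ⟨i, y, hy⟩ := Nat.rfindOpt_dom.1 hx
        obtain ⟨i', y', hy'⟩ := Nat.rfindOpt_dom.1 hx'
        obtain rfl := allocated_disjoint hy hy' h
        have h1 := (allocated_eq_some.1 hy).1.symm.trans (allocated_eq_some.1 hy').1
        refine h.eq_of_length ?_
        simp only [Option.some.injEq, Prod.mk.injEq] at h1
        exact h1.1 }
  refine ⟨V, fun i n y hi => ?_⟩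
  -- The right end of the allocated interval is at most twice the total weight, hence at most `1`;
  -- so the codeword has a binary expansion of `n` digits.
  have hlt : ceilAt (freeFrom req i) n < 2 ^ n := by
    have h1 := (dyadic_freeFrom_le (req := req) (i + 1)).trans
      (mul_le_mul_of_nonneg_left (hsum (i + 1)) two_pos.le)
    rw [freeFrom_succ_some hi, dyadic, mul_one_div_cancel two_ne_zero,
      div_le_one (by positivity)] at h1
    have h2 : ceilAt (freeFrom req i) n + 1 ≤ 2 ^ n := by exact_mod_cast h1
    omega
  obtain ⟨z, rfl, hz⟩ := exists_binVal n _ hlt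
  have hzi : allocated req z i = some y := allocated_eq_some.2 ⟨hi, hz⟩
  have hdom : (Nat.rfindOpt (allocated req z)).Dom := Nat.rfindOpt_dom.2 ⟨i, y, hzi⟩
  obtain ⟨y', hy'⟩ := Part.dom_iff_mem.1 hdom
  obtain ⟨j, hj⟩ := Nat.rfindOpt_spec hy'
  -- The search may stop at another index a priori, but a codeword belongs to only one request.
  obtain rfl := allocated_disjoint hj hzi List.prefix_rfl
  have : some y' = some y := hj.symm.trans hzi
  obtain rfl := Option.some.inj this
  exact ⟨z, rfl, hy'⟩

end Allocation
-- Approximating algorithmic probability from below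
section Enumeration

open Nat.Partrec (Code)

theorem primrec_sum_range {α : Type*} [Primcodable α] {n : α → ℕ} {f : α → ℕ → ℕ}
    (hn : Primrec n) (hf : Primrec₂ f) : Primrec fun a => ∑ j ∈ Finset.range (n a), f a j := by
  have hstep : Primrec₂ fun (a : α) (q : ℕ × ℕ) => q.2 + f a q.1 :=
    Primrec.nat_add.comp (Primrec.snd.comp Primrec.snd)
      (hf.comp Primrec.fst (Primrec.fst.comp Primrec.snd))
  refine (Primrec.nat_rec' hn (Primrec.const 0) hstep).of_eq fun a => ?_
  induction n a with
  | zero => rfl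
  | succ k ih => rw [Finset.sum_range_succ, ← ih]

/-- The length of the string with code `j`. -/
def codeLength (j : ℕ) : ℕ := ((Encodable.decode j : Option (List Bool)).getD []).length

theorem codeLength_encode (x : List Bool) : codeLength (Encodable.encode x) = x.length := by
  simp [codeLength]

theorem primrec_codeLength : Primrec codeLength :=
  Primrec.list_length.comp (Primrec.option_getD.comp Primrec.decode (Primrec.const []))

/-- The input with code `j`, of length at most `t`, is seen to lead to output `y` within `t`
steps. -/
def HaltsBy (c : Code) (t : ℕ) (y : List Bool) (j : ℕ) : Prop :=
  Code.evaln t c j = some (Encodable.encode y) ∧ codeLength j ≤ t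

instance (c : Code) (t : ℕ) (y : List Bool) : DecidablePred (HaltsBy c t y) :=
  fun _ => inferInstanceAs (Decidable (_ ∧ _))

theorem HaltsBy.mono {c : Code} {t t' : ℕ} {y : List Bool} {j : ℕ} (h : HaltsBy c t y j)
    (ht : t ≤ t') : HaltsBy c t' y j :=
  ⟨Code.evaln_mono ht h.1, h.2.trans ht⟩

/-- The codes of the inputs that are seen to lead to output `y` within `t` steps. -/
def haltedBy (c : Code) (t : ℕ) (y : List Bool) : Finset ℕ :=
  {j ∈ Finset.range t | HaltsBy c t y j}

/-- The weight of the inputs seen to lead to `y` within `t` steps, in units of `2 ^ (-t)`. -/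
def scaledMass (c : Code) (t : ℕ) (y : List Bool) : ℕ :=
  ∑ j ∈ Finset.range t, if HaltsBy c t y j then 2 ^ (t - codeLength j) else 0

theorem primrec₂_scaledMass (c : Code) : Primrec₂ (scaledMass c) := by
  have ht : Primrec fun a : (ℕ × List Bool) × ℕ => a.1.1 := Primrec.fst.comp Primrec.fst
  have hl : Primrec fun a : (ℕ × List Bool) × ℕ => codeLength a.2 :=
    primrec_codeLength.comp Primrec.snd
  have he : Primrec fun a : (ℕ × List Bool) × ℕ => Code.evaln a.1.1 c a.2 :=
    Code.primrec_evaln.comp (Primrec.pair (Primrec.pair ht (Primrec.const c)) Primrec.snd)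
  have h1 : PrimrecPred fun a : (ℕ × List Bool) × ℕ =>
      Code.evaln a.1.1 c a.2 = some (Encodable.encode a.1.2) :=
    Primrec.eq.comp he (Primrec.option_some.comp
      (Primrec.encode.comp (Primrec.snd.comp Primrec.fst)))
  have h2 : PrimrecPred fun a : (ℕ × List Bool) × ℕ => codeLength a.2 ≤ a.1.1 :=
    Primrec.nat_le.comp hl ht
  have h3 : Primrec fun a : (ℕ × List Bool) × ℕ => 2 ^ (a.1.1 - codeLength a.2) :=
    primrec₂_pow.comp (Primrec.const 2) (Primrec.nat_sub.comp ht hl)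
  have h4 : Primrec₂ fun (a : ℕ × List Bool) (j : ℕ) =>
      if HaltsBy c a.1 a.2 j then 2 ^ (a.1 - codeLength j) else 0 :=
    Primrec.ite (h1.and h2) h3 (Primrec.const 0)
  exact primrec_sum_range Primrec.fst h4

/-- The length bound in `HaltsBy` keeps the truncated subtraction in the exponent exact, so the
integer computation loses nothing. -/
theorem scaledMass_div (c : Code) (t : ℕ) (y : List Bool) :
    (scaledMass c t y : ℝ) / 2 ^ t = ∑ j ∈ haltedBy c t y, (1 / 2 : ℝ) ^ codeLength j := by
  rw [scaledMass, ← Finset.sum_filter, Nat.cast_sum, Finset.sum_div]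
  refine Finset.sum_congr rfl fun j hj => ?_
  have hj' := (Finset.mem_filter.1 hj).2.2
  push_cast
  rw [pow_sub₀ _ two_ne_zero hj', one_div_pow]
  field_simp

theorem haltedBy_mono (c : Code) (y : List Bool) : Monotone fun t => haltedBy c t y := by
  intro t t' ht j hj
  simp only [haltedBy, Finset.mem_filter, Finset.mem_range] at hj ⊢
  exact ⟨by omega, hj.2.mono ht⟩

/-- By step `t`, the weight of the inputs that lead to `y` is seen to be at least `2 ^ (-n)`. -/
def Exceeds (c : Code) (t : ℕ) (y : List Bool) (n : ℕ) : Prop :=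
  2 ^ t ≤ scaledMass c t y * 2 ^ n

instance (c : Code) (t : ℕ) (y : List Bool) (n : ℕ) : Decidable (Exceeds c t y n) :=
  inferInstanceAs (Decidable (_ ≤ _))

theorem exceeds_iff {c : Code} {t : ℕ} {y : List Bool} {n : ℕ} :
    Exceeds c t y n ↔
      (1 / 2 : ℝ) ^ n ≤ ∑ j ∈ haltedBy c t y, (1 / 2 : ℝ) ^ codeLength j := by
  rw [← scaledMass_div, one_div_pow, div_le_div_iff₀ (by positivity) (by positivity), one_mul,
    Exceeds]
  exact_mod_cast Iff.rfl

theorem Exceeds.mono {c : Code} {t t' : ℕ} {y : List Bool} {n : ℕ} (h : Exceeds c t y n)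
    (ht : t ≤ t') : Exceeds c t' y n := by
  rw [exceeds_iff] at h ⊢
  exact h.trans (Finset.sum_le_sum_of_subset_of_nonneg (haltedBy_mono c y ht)
    fun _ _ _ => by positivity)

theorem not_exceeds_zero (c : Code) (y : List Bool) (n : ℕ) : ¬ Exceeds c 0 y n := by
  simp [Exceeds, scaledMass]

/-- Request a codeword of length `n + 2` for `y` when the weight of the inputs that lead to `y` is
first seen to be at least `2 ^ (-n)`. -/
def requestOf (c : Code) (q : ℕ × List Bool × ℕ) : Option (ℕ × List Bool) :=
  if Exceeds c (q.1 + 1) q.2.1 q.2.2 ∧ ¬ Exceeds c q.1 q.2.1 q.2.2 then some (q.2.2 + 2, q.2.1)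
  else none

/-- The sequence of all requests. -/
def requests (c : Code) (i : ℕ) : Option (ℕ × List Bool) :=
  (Encodable.decode₂ (ℕ × List Bool × ℕ) i).bind (requestOf c)

theorem computable_requests (c : Code) : Computable (requests c) := by
  have hy : Primrec fun q : ℕ × List Bool × ℕ => q.2.1 := Primrec.fst.comp Primrec.snd
  have hn : Primrec fun q : ℕ × List Bool × ℕ => q.2.2 := Primrec.snd.comp Primrec.snd
  have hex : ∀ {t : ℕ × List Bool × ℕ → ℕ}, Primrec t →
      PrimrecPred fun q : ℕ × List Bool × ℕ => Exceeds c (t q) q.2.1 q.2.2 := fun ht =>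
    Primrec.nat_le.comp (primrec₂_pow.comp (Primrec.const 2) ht)
      (Primrec.nat_mul.comp ((primrec₂_scaledMass c).comp ht hy)
        (primrec₂_pow.comp (Primrec.const 2) hn))
  have hreq : Primrec (requestOf c) :=
    Primrec.ite ((hex (Primrec.succ.comp Primrec.fst)).and (hex Primrec.fst).not)
      (Primrec.option_some.comp (Primrec.pair
        (Primrec.nat_add.comp hn (Primrec.const 2)) hy)) (Primrec.const none)
  have hreq₂ : Primrec₂ fun (_ : ℕ) q => requestOf c q := hreq.comp Primrec.snd
  exact (Primrec.option_bind Primrec.decode₂ hreq₂).to_comp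

/-- Decoding by `decode₂` makes the index recoverable from the triple, so no triple is requested
under two indices. -/
theorem requests_eq_some {c : Code} {i m : ℕ} {y : List Bool} (h : requests c i = some (m, y)) :
    ∃ t n, Encodable.encode (t, y, n) = i ∧ m = n + 2 ∧
      Exceeds c (t + 1) y n ∧ ¬ Exceeds c t y n := by
  simp only [requests, Option.bind_eq_some_iff] at h
  obtain ⟨⟨t, y', n⟩, hd, h⟩ := h
  simp only [requestOf, Option.ite_none_right_eq_some, Option.some.injEq, Prod.mk.injEq] at h
  obtain ⟨h1, rfl, rfl⟩ := h
  exact ⟨t, n, Encodable.mem_decode₂.1 hd, rfl, h1⟩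

theorem requests_encode {c : Code} {t n : ℕ} {y : List Bool} (h : Exceeds c (t + 1) y n)
    (h' : ¬ Exceeds c t y n) : requests c (Encodable.encode (t, y, n)) = some (n + 2, y) := by
  rw [requests, Encodable.decode₂_encode, Option.bind_some]
  exact if_pos ⟨h, h'⟩

/-- A geometric sum is at most twice its largest term, which belongs to the least exponent. Hence
requests at all levels `n` with `2 ^ (-n) ≤ m` cost no more than a constant times `m`. -/
theorem sum_half_pow_le {A : Finset ℕ} {m : ℝ} (hm : 0 ≤ m) (hA : ∀ n ∈ A, (1 / 2 : ℝ) ^ n ≤ m) :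
    ∑ n ∈ A, (1 / 2 : ℝ) ^ n ≤ 2 * m := by
  rcases A.eq_empty_or_nonempty with rfl | hne
  · simpa using hm
  obtain ⟨N, hN⟩ := A.exists_nat_subset_range
  have hsub : A ⊆ Finset.Ico (A.min' hne) N := fun n hn =>
    Finset.mem_Ico.2 ⟨A.min'_le n hn, Finset.mem_range.1 (hN hn)⟩
  calc ∑ n ∈ A, (1 / 2 : ℝ) ^ n ≤ ∑ n ∈ Finset.Ico (A.min' hne) N, (1 / 2 : ℝ) ^ n :=
        Finset.sum_le_sum_of_subset_of_nonneg hsub fun _ _ _ => by positivity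
    _ = (1 / 2 : ℝ) ^ (A.min' hne) * ∑ k ∈ Finset.range (N - A.min' hne), (1 / 2 : ℝ) ^ k := by
        rw [Finset.sum_Ico_eq_sum_range, Finset.mul_sum]
        exact Finset.sum_congr rfl fun k _ => pow_add _ _ _
    _ ≤ (1 / 2 : ℝ) ^ (A.min' hne) * 2 :=
        mul_le_mul_of_nonneg_left (sum_geometric_two_le _) (by positivity)
    _ ≤ m * 2 := mul_le_mul_of_nonneg_right (hA _ (A.min'_mem hne)) zero_le_two
    _ = 2 * m := mul_comm _ _

end Enumeration

/-! ### The coding theorem -/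

namespace PrefixMachine

open Nat.Partrec (Code)

variable (M : PrefixMachine)

theorem haltingProb_le_one : M.haltingProb ≤ 1 := by
  refine hasSum_le_of_sum_le M.summable_dom.hasSum fun u => ?_
  exact M.sum_dom_le_one u

/-- The code `c` computes the partial function of `M`. -/
def HasCode (M : PrefixMachine) (c : Code) : Prop :=
  ∀ j y, Encodable.encode y ∈ c.eval j ↔ ∃ x : List Bool, Encodable.encode x = j ∧ y ∈ M.φ x

theorem exists_hasCode : ∃ c : Code, M.HasCode c := by
  obtain ⟨c, hc⟩ := Code.exists_code.1 (Partrec.bind_decode₂_iff.1 M.partrec)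
  refine ⟨c, fun j y => ?_⟩
  rw [hc]
  simp [Encodable.decode₂_eq_some]

variable {M}

theorem sum_haltedBy_le {c : Code} (hc : M.HasCode c) (t : ℕ) (y : List Bool) :
    ∑ j ∈ haltedBy c t y, (1 / 2 : ℝ) ^ codeLength j ≤ M.mY y := by
  have hmem : ∀ j ∈ haltedBy c t y, ∃ x : List Bool, Encodable.encode x = j ∧ y ∈ M.φ x :=
    fun j hj => (hc j y).1 (Code.evaln_sound (Finset.mem_filter.1 hj).2.1)
  have hinj : Set.InjOn (Encodable.encode : List Bool → ℕ)
      (Encodable.encode ⁻¹' ↑(haltedBy c t y)) := Encodable.encode_injective.injOn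
  rw [← Finset.sum_preimage Encodable.encode _ hinj _ fun j hj hj' => by
    obtain ⟨x, hx, -⟩ := hmem j hj
    exact absurd ⟨x, hx⟩ hj']
  simp only [codeLength_encode]
  refine M.sum_fiber_le fun x hx => ?_
  obtain ⟨x', hx', hy⟩ := hmem _ (Finset.mem_preimage.1 hx)
  exact Encodable.encode_injective hx' ▸ hy

/-- The strict inequality lets a finite part of the fiber suffice, and finitely many computations
have all been seen by some common step. -/
theorem exists_exceeds {c : Code} (hc : M.HasCode c) {y : List Bool} {n : ℕ}
    (h : (1 / 2 : ℝ) ^ n < M.mY y) :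
    ∃ t, Exceeds c t y n := by
  obtain ⟨F, hF⟩ := ((M.summable_fiber y).hasSum.eventually (lt_mem_nhds h)).exists
  have hev : ∀ x ∈ F, ∀ᶠ t in atTop, Encodable.encode x.1 ∈ haltedBy c t y := by
    intro x _
    obtain ⟨k, hk⟩ := Code.evaln_complete.1 ((hc (Encodable.encode x.1) y).2 ⟨x.1, rfl, x.2⟩)
    filter_upwards [eventually_ge_atTop k, eventually_ge_atTop x.1.length,
      eventually_gt_atTop (Encodable.encode x.1)] with t h1 h2 h3
    exact Finset.mem_filter.2 ⟨Finset.mem_range.2 h3, Code.evaln_mono h1 hk,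
      by rwa [codeLength_encode]⟩
  obtain ⟨t, ht⟩ := ((Finset.eventually_all F).2 hev).exists
  refine ⟨t, exceeds_iff.2 (hF.le.trans ?_)⟩
  have hinj : Function.Injective fun x : {x : List Bool // y ∈ M.φ x} => Encodable.encode x.1 :=
    Encodable.encode_injective.comp Subtype.val_injective
  calc ∑ x ∈ F, (1 / 2 : ℝ) ^ x.1.length
      = ∑ j ∈ F.map ⟨_, hinj⟩, (1 / 2 : ℝ) ^ codeLength j := by
        rw [Finset.sum_map]
        exact Finset.sum_congr rfl fun x _ => by simp [codeLength_encode]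
    _ ≤ _ := by
        refine Finset.sum_le_sum_of_subset_of_nonneg ?_ fun _ _ _ => by positivity
        intro j hj
        obtain ⟨x, hx, rfl⟩ := Finset.mem_map.1 hj
        exact ht x hx

theorem sum_pow_le_two (M : PrefixMachine) {J : Finset (ℕ × List Bool)}
    (hJ : ∀ r ∈ J, (1 / 2 : ℝ) ^ r.1 ≤ M.mY r.2) : ∑ r ∈ J, (1 / 2 : ℝ) ^ r.1 ≤ 2 := by
  have hfib : ∀ y, ∑ r ∈ J with r.2 = y, (1 / 2 : ℝ) ^ r.1 ≤ 2 * M.mY y := by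
    intro y
    have h1 : Set.InjOn Prod.fst (↑(J.filter fun r => r.2 = y) : Set (ℕ × List Bool)) := by
      intro r hr r' hr' h
      exact Prod.ext h ((Finset.mem_filter.1 hr).2.trans (Finset.mem_filter.1 hr').2.symm)
    rw [← Finset.sum_image (f := fun n : ℕ => (1 / 2 : ℝ) ^ n) h1]
    refine sum_half_pow_le (M.mY_nonneg y) fun n hn => ?_
    obtain ⟨r, hr, rfl⟩ := Finset.mem_image.1 hn
    have hr' := Finset.mem_filter.1 hr
    exact hr'.2 ▸ hJ r hr'.1
  calc ∑ r ∈ J, (1 / 2 : ℝ) ^ r.1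
      = ∑ y ∈ J.image Prod.snd, ∑ r ∈ J with r.2 = y, (1 / 2 : ℝ) ^ r.1 :=
        (Finset.sum_fiberwise_of_maps_to
          (fun r hr => Finset.mem_image_of_mem Prod.snd hr) _).symm
    _ ≤ ∑ y ∈ J.image Prod.snd, 2 * M.mY y := Finset.sum_le_sum fun y _ => hfib y
    _ ≤ 2 * 1 := by
        rw [← Finset.mul_sum]
        exact mul_le_mul_of_nonneg_left ((sum_le_hasSum _ (fun y _ => M.mY_nonneg y)
          M.hasSum_mY).trans M.haltingProb_le_one) zero_le_two
    _ = 2 := mul_one 2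

/-- The two extra digits of a request give a factor `1 / 4`; the weights `2 ^ (-n)` of the distinct
pairs `(n, y)` add up to at most `2`. -/
theorem sum_requestWeight_le {c : Code} (hc : M.HasCode c) (N : ℕ) :
    ∑ i ∈ Finset.range N, requestWeight (requests c i) ≤ 1 / 2 := by
  classical
  obtain ⟨I, hIdef⟩ : ∃ I, I = {i ∈ Finset.range N | requests c i ≠ none} := ⟨_, rfl⟩
  have hI : ∀ i, ∃ q : ℕ × List Bool, i ∈ I → ∃ t, Encodable.encode (t, q.2, q.1) = i ∧
      requests c i = some (q.1 + 2, q.2) ∧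
      Exceeds c (t + 1) q.2 q.1 ∧ ¬ Exceeds c t q.2 q.1 := by
    intro i
    by_cases hi : i ∈ I
    · rw [hIdef] at hi
      obtain ⟨⟨m, y⟩, h⟩ := Option.ne_none_iff_exists'.1 (Finset.mem_filter.1 hi).2
      obtain ⟨t, n, h1, rfl, h2⟩ := requests_eq_some h
      exact ⟨(n, y), fun _ => ⟨t, h1, h, h2⟩⟩
    · exact ⟨(0, []), fun h => absurd h hi⟩
  choose q hq using hI
  -- A pair `(n, y)` is requested only at the step when its threshold is first passed, and `Exceeds`
  -- is monotone in time.
  have hinj : Set.InjOn q I := by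
    intro i hi i' hi' h
    obtain ⟨t, h1, -, h2, h3⟩ := hq i hi
    obtain ⟨t', h1', -, h2', h3'⟩ := hq i' hi'
    rw [h] at h1 h2 h3
    have : t = t' := by
      by_contra hne
      rcases Nat.lt_or_gt_of_ne hne with hlt | hlt
      · exact h3' (h2.mono hlt)
      · exact h3 (h2'.mono hlt)
    subst this
    exact h1.symm.trans h1'
  have hw : ∀ i ∈ I, requestWeight (requests c i) = 1 / 4 * (1 / 2) ^ (q i).1 := by
    intro i hi
    obtain ⟨t, -, h, -⟩ := hq i hi
    rw [h, requestWeight, Option.elim_some, pow_add]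
    ring
  have hle : ∀ r ∈ I.image q, (1 / 2 : ℝ) ^ r.1 ≤ M.mY r.2 := by
    intro r hr
    obtain ⟨i, hi, rfl⟩ := Finset.mem_image.1 hr
    obtain ⟨t, -, -, h, -⟩ := hq i hi
    exact (exceeds_iff.1 h).trans (sum_haltedBy_le hc _ _)
  have hsub : ∑ i ∈ Finset.range N, requestWeight (requests c i)
      = ∑ i ∈ I, requestWeight (requests c i) := by
    rw [hIdef]
    exact (Finset.sum_filter_of_ne (p := fun i => requests c i ≠ none)
      fun i _ h h0 => h (by rw [h0]; rfl)).symm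
  have himg : ∑ i ∈ I, requestWeight (requests c i)
      = 1 / 4 * ∑ r ∈ I.image q, (1 / 2 : ℝ) ^ r.1 := by
    rw [Finset.sum_image hinj, Finset.mul_sum]
    exact Finset.sum_congr rfl hw
  rw [hsub, himg]
  linarith [M.sum_pow_le_two hle]

/-- The coding theorem: some prefix machine has, for every output `y` of `M`, a program of length
`- log₂ m_Y(y) + O(1)`. -/
theorem exists_coding_machine (M : PrefixMachine) : ∃ V : PrefixMachine, ∀ x y, y ∈ M.φ x →
    ∃ z, y ∈ V.φ z ∧ M.mY y ≤ 8 * (1 / 2) ^ z.length := by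
  classical
  obtain ⟨c, hc⟩ := M.exists_hasCode
  obtain ⟨V, hV⟩ := exists_prefixMachine_of_requests (computable_requests c)
    (sum_requestWeight_le hc)
  refine ⟨V, fun x y hxy => ?_⟩
  have hex : ∃ n, (1 / 2 : ℝ) ^ n < M.mY y :=
    exists_pow_lt_of_lt_one (M.mY_pos hxy) (by norm_num)
  -- The least such `n` locates `m_Y(y)` up to a factor `2`. With the two extra digits of the
  -- codeword this makes the `8` of the statement.
  obtain ⟨n, hn, hmin⟩ : ∃ n, (1 / 2 : ℝ) ^ n < M.mY y ∧ M.mY y ≤ 2 * (1 / 2) ^ n := by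
    refine ⟨Nat.find hex, Nat.find_spec hex, ?_⟩
    rcases h : Nat.find hex with _ | k
    · have := (le_hasSum M.hasSum_mY y fun _ _ => M.mY_nonneg _).trans M.haltingProb_le_one
      rw [pow_zero]
      linarith
    · have := not_lt.1 (Nat.find_min hex (show k < Nat.find hex by omega))
      rw [pow_succ]
      linarith
  have ht := exists_exceeds hc hn
  -- Nothing has been seen at step `0`, so the threshold is first passed at a successor step, where
  -- the request is issued.
  rcases h : Nat.find ht with _ | t
  · exact absurd (h ▸ Nat.find_spec ht) (not_exceeds_zero c y n)
  · have h1 : Exceeds c (t + 1) y n := h ▸ Nat.find_spec ht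
    have h2 : ¬ Exceeds c t y n := Nat.find_min ht (by omega)
    obtain ⟨z, hz, hyz⟩ := hV _ _ _ (requests_encode h1 h2)
    refine ⟨z, hyz, hmin.trans_eq ?_⟩
    rw [hz, pow_add]
    ring

end PrefixMachine
-- Universal machines and thermodynamic complexity
namespace PrefixMachine

/-- The machine that outputs `y` on the empty input and halts on no other input. -/
def constant (y : List Bool) : PrefixMachine where
  φ := fun x => ((if x = [] then some y else none : Option (List Bool)) : Part (List Bool))
  partrec := Computable.ofOption
    (Primrec.ite (Primrec.eq.comp Primrec.id (Primrec.const [])) (Primrec.const (some y))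
      (Primrec.const none)).to_comp
  prefixFree := by
    have h : ∀ x : List Bool, ((if x = [] then some y else none : Option (List Bool)) :
        Part (List Bool)).Dom → x = [] := by
      intro x hx
      by_contra hne
      simp [hne] at hx
    intro x hx x' hx' _
    rw [h x hx, h x' hx']

variable {U V : PrefixMachine}

theorem IsUniversal.exists_program (hU : U.IsUniversal) (y : List Bool) : ∃ x, y ∈ U.φ x := by
  obtain ⟨pair, -, h⟩ := hU
  obtain ⟨σ, hσ⟩ := h (constant y)
  refine ⟨pair σ [], ?_⟩
  rw [hσ]
  simp [constant]

theorem exists_shortest_program {y : List Bool} (h : ∃ x, y ∈ V.φ x) :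
    ∃ z, y ∈ V.φ z ∧ z.length = V.kolmogorov y :=
  Nat.sInf_mem (s := {n | ∃ z, y ∈ V.φ z ∧ z.length = n}) (h.imp' _ fun x hx => ⟨x, hx, rfl⟩)

theorem kolmogorov_le {y z : List Bool} (h : y ∈ V.φ z) : V.kolmogorov y ≤ z.length :=
  Nat.sInf_le ⟨z, h, rfl⟩

/-- A universal machine has programs that are longer than those of another machine by at most a
constant. -/
theorem IsUniversal.exists_simulation (hU : U.IsUniversal) (V : PrefixMachine) :
    ∃ c : ℕ, ∀ z y, y ∈ V.φ z → ∃ x, y ∈ U.φ x ∧ x.length ≤ z.length + c := by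
  obtain ⟨pair, hc, h⟩ := hU
  obtain ⟨σ, hσ⟩ := h V
  obtain ⟨c, hc⟩ := hc σ
  exact ⟨c, fun z y hz => ⟨pair σ z, by rwa [hσ], hc z⟩⟩

theorem logb_half_pow (n : ℕ) : Real.logb 2 ((1 / 2 : ℝ) ^ n) = -n := by
  rw [one_div, Real.logb_pow, Real.logb_inv, Real.logb_self_eq_one one_lt_two]
  ring

/-- Algorithmic probability and Kolmogorov complexity, also of another universal machine, agree up
to a constant. -/
theorem exists_abs_logb_mY_add_kolmogorov_le (hU : U.IsUniversal) (hV : V.IsUniversal) :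
    ∃ C : ℝ, ∀ y, |Real.logb 2 (U.mY y) + V.kolmogorov y| ≤ C := by
  obtain ⟨W, hW⟩ := U.exists_coding_machine
  obtain ⟨c, hc⟩ := hV.exists_simulation W
  obtain ⟨d, hd⟩ := hU.exists_simulation V
  -- `d` is the overhead of simulating `V` on `U`, `c` that of simulating the coding machine on `V`,
  -- and `3 = log₂ 8` is the loss in the coding theorem.
  refine ⟨max d (3 + c), fun y => abs_le.2 ⟨?_, ?_⟩⟩
  · obtain ⟨z, hz, hzK⟩ := exists_shortest_program (hV.exists_program y)
    obtain ⟨x, hx, hxz⟩ := hd z y hz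
    have h1 := Real.logb_le_logb_of_le one_lt_two (by positivity) (U.pow_le_mY hx)
    rw [logb_half_pow] at h1
    have h2 : (x.length : ℝ) ≤ V.kolmogorov y + d := by
      rw [← hzK]
      exact_mod_cast hxz
    have := le_max_left (d : ℝ) (3 + c)
    linarith
  · obtain ⟨x, hx⟩ := hU.exists_program y
    obtain ⟨z, hz, hle⟩ := hW x y hx
    obtain ⟨z', hz', hlen⟩ := hc z y hz
    have h1 := Real.logb_le_logb_of_le one_lt_two (U.mY_pos hx) hle
    have h8 : Real.logb 2 (8 : ℝ) = 3 := by
      rw [show (8 : ℝ) = 2 ^ 3 by norm_num, Real.logb_pow, Real.logb_self_eq_one one_lt_two]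
      norm_num
    rw [Real.logb_mul (by norm_num) (by positivity), logb_half_pow, h8] at h1
    have h2 : (V.kolmogorov y : ℝ) ≤ z.length + c := by
      exact_mod_cast (kolmogorov_le hz').trans hlen
    have := le_max_right (d : ℝ) (3 + c)
    linarith

variable {kT : ℝ} {R : Realization U.φ kT}

theorem IsCoinFlipping.heat_eq (hR : U.IsCoinFlipping R) {x y : List Bool} (h : y ∈ U.φ x) :
    R.heat x = kT * Real.log 2 * (x.length + Real.logb 2 (U.mY y)) := by
  rw [hR x y h, U.coin_heat_eq h, mul_assoc]

/-- Among the inputs with output `y` the heat depends on the length alone, and increases with it. -/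
theorem IsCoinFlipping.isLeast_heatsOf (hR : U.IsCoinFlipping R) (hkT : 0 < kT)
    {y : List Bool} (h : ∃ x, y ∈ U.φ x) :
    IsLeast (R.heatsOf y) (kT * Real.log 2 * (U.kolmogorov y + Real.logb 2 (U.mY y))) := by
  obtain ⟨z, hz, hzK⟩ := exists_shortest_program h
  refine ⟨⟨z, hz, by rw [hR.heat_eq hz, hzK]⟩, ?_⟩
  rintro _ ⟨x, hx, rfl⟩
  rw [hR.heat_eq hx]
  have h1 : (U.kolmogorov y : ℝ) ≤ x.length := by exact_mod_cast kolmogorov_le hx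
  have := Real.log_pos one_lt_two
  gcongr

end PrefixMachine
end TMThermo

open TMThermo in
theorem mainTheorem3 (k T : ℝ) (hk : 0 < k) (hT : 0 < T) :
    -- every prefix machine: existence, heat function, reversibility
    (∀ M : PrefixMachine,
      (M.φ.Dom.Nonempty → HasSum M.coinInput 1) ∧
      (∃ R : Realization M.φ (k * T), M.IsCoinFlipping R) ∧
      ∀ R : Realization M.φ (k * T), M.IsCoinFlipping R →
        (∀ x y, y ∈ M.φ x →
          R.heat x = k * T * Real.log 2 * (x.length + Real.logb 2 (M.mY y))) ∧
        R.HasEntropyProduction M.coinInput 0 ∧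
        (Summable (fun x => Real.negMulLog (M.coinInput x)) →
          Summable (fun y => Real.negMulLog (outputDist M.φ M.coinInput y)) ∧
          Summable (fun x => M.coinInput x * R.heat x) ∧
          R.entropyProduction M.coinInput = 0)) ∧
    -- universal machines: heat is excess program length, for Kolmogorov complexity relative to any
    -- universal machine
    (∀ U V : PrefixMachine, U.IsUniversal → V.IsUniversal →
      ∃ κ : ℝ, ∀ R : Realization U.φ (k * T), U.IsCoinFlipping R → ∀ x y, y ∈ U.φ x →
        |R.heat x - k * T * Real.log 2 * ((x.length : ℝ) - (V.kolmogorov y : ℝ))| ≤ κ) ∧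
    -- universal machines: thermodynamic complexity is bounded
    (∀ U : PrefixMachine, U.IsUniversal →
      ∃ κ : ℝ, ∀ R : Realization U.φ (k * T), U.IsCoinFlipping R → ∀ y,
        IsLeast (R.heatsOf y) (R.thermoComplexity y) ∧ |R.thermoComplexity y| ≤ κ) := by

  have hkT : 0 < k * T := mul_pos hk hT
  have hpos : 0 < k * T * Real.log 2 := mul_pos hkT (Real.log_pos one_lt_two)
  refine ⟨fun M => ⟨M.hasSum_coinInput, M.exists_coinFlipping hkT, fun R hR =>
    ⟨fun x y h => hR.heat_eq h, M.hasEntropyProduction_coinInput hkT.ne' hR,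
      M.finite_entropy hkT.ne' hR⟩⟩, fun U V hU hV => ?_, fun U hU => ?_⟩
  · obtain ⟨C, hC⟩ := PrefixMachine.exists_abs_logb_mY_add_kolmogorov_le hU hV
    refine ⟨k * T * Real.log 2 * C, fun R hR x y h => ?_⟩
    rw [hR.heat_eq h, ← mul_sub, abs_mul, abs_of_pos hpos]
    refine mul_le_mul_of_nonneg_left ((congrArg abs ?_).trans_le (hC y)) hpos.le
    ring
  -- The least heat is `kT ln 2` times `K_U(y) + log₂ m_Y(y)`, which the coding theorem with `V = U`
  -- bounds.
  · obtain ⟨C, hC⟩ := PrefixMachine.exists_abs_logb_mY_add_kolmogorov_le hU hU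
    refine ⟨k * T * Real.log 2 * C, fun R hR y => ?_⟩
    have hleast := hR.isLeast_heatsOf hkT (hU.exists_program y)
    have heq : R.thermoComplexity y = _ := hleast.csInf_eq
    rw [heq]
    refine ⟨hleast, ?_⟩
    rw [abs_mul, abs_of_pos hpos, add_comm]
    exact mul_le_mul_of_nonneg_left (hC y) hpos.le
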